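/- Let $\mathcal G$ be a weighted digraph with agents $1,\dots,m$ and weights $a_{ij}\ge 0$, $a_{ii}=0$, where $a_{ij}>0$ means that there is a link from agent $j$ to agent $i$ ($j$ is an in-neighbour of $i$). Let $L=A-D$, $D=\mathrm{diag}(\sum_j a_{ij})$, be its Laplacian. Suppose that $\mathcal G$ has a directed spanning tree and that $L$ is in block upper triangular Frobenius form with diagonal blocks $L^{1,1},\dots,L^{K,K}$: the blocks correspond to the strongly connected components of $\mathcal G$, and for each $k<K$ there is $j>k$ with $L^{k,j}\neq0$. Then there is exactly one positive vector $\xi^K=(\xi^K_p)_p$ with $\sum_p\xi^K_p=1$ and $(\xi^K)^\top L^{K,K}=0$. Consider the event-triggered system $$\dot x_i(t)=\sum_{j=1}^m L_{ij}\,\hat x_j(t),\qquad \hat x_j(t)=x_j\big(t^j_{k_j(t)}\big),\qquad k_j(t)=\max\{k: t^j_k\le t\},$$ where the trigger times $0=t^i_1\le t^i_2\le\cdots\le+\infty$ of agent $i$ are generated by one of the following rules, the same one for all agents. The value $t^i_{k+1}=+\infty$ means that agent $i$ does not trigger after $t^i_k$. In computing $t^i_{k+1}$, the motion is the one in which agent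 $i$ does not trigger again after $t^i_k$, and "largest $\tau$" means the supremum of such $\tau$. Triggers at the same instant are executed in a causal order: an agent that decides whether to trigger at an instant sees those triggers of other agents at this instant that precede its own, and a trigger in response to information received at the same instant comes after the trigger that sends this information. The system is considered on its maximal interval of existence $[0,T)$: only finitely many triggers occur in $[0,s]$ for each $s<T$, and $T<\infty$ only if some agent triggers infinitely often in $[0,T)$. * Rule 1. With $\gamma_i\in(0,1)$, $t^i_{k+1}$ is the largest $\tau\ge t^i_k$ such that $|x_i(t^i_k)-x_i(t)|\le\sqrt{\tfrac{\gamma_i}{4|L_{ii}|}\sum_j L_{ij}(x_j(t)-x_i(t))^2}$ for all $t\in[t^i_k,\tau]$. * Rule 2. With $\phi_i>0$, $\alpha_i>0$, $t^i_{k+1}$ is the largest $\tau\ge t^i_k$ such that $|x_i(t^i_k)-x_i(t)|\le\phi_ie^{-\alpha_it}$ for all $t\in[t^i_k,\tau]$. * Rule 3. With $\gamma_i\in(0,1)$ and $0<\varepsilon_i<\sqrt{\gamma_i}/(2|L_{ii}|)$, let $\tau^i_{k+1}$ be the largest $\tau\ge t^i_k$ such that $|\hat x_i(t)-x_i(t)|\le\sqrt{\tfrac{\gamma_i}{4|L_{ii}|}\sum_jL_{ij}(\hat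 x_j(t)-\hat x_i(t))^2}$ for all $t\in[t^i_k,\tau]$. If some in-neighbour of agent $i$ triggers at a time $t_0\in(t^i_k,\tau^i_{k+1}]$ with $t_0-t^i_k<\varepsilon_i$, then $t^i_{k+1}$ is the first such time; otherwise $t^i_{k+1}=\tau^i_{k+1}$. (If $L_{ii}=0$, agent $i$ has no in-neighbours; then the right-hand sides in Rules 1 and 3 are $0$ and the upper bound on $\varepsilon_i$ is void.) Let $\bar x(0)=\sum_p\xi^K_p\,x^K_p(0)$, where $x^K_p$ are the states of the agents in the $K$-th component. Then: 1. Under Rule 1, if $\lim_{k\to\infty}t^i_k=+\infty$ for all $i$, then the system reaches consensus exponentially, and for all $i,k$ with $t^i_k<\infty$ and $x_i(t^i_k)\neq\bar x(0)$ agent $i$ triggers again, with $t^i_k<t^i_{k+1}<\infty$. 2. Under Rule 2 and under Rule 3, $T=+\infty$, no agent triggers infinitely often in a finite time interval (Zeno behaviour is excluded), and the system reaches consensus exponentially. In all cases $\lim_{t\to\infty}x_i(t)=\bar x(0)$ for all $i$, and there are $c>0$, depending only on the digraph and the parameters of the rule, and $C$, depending also on the run, such that $|x_i(t)-\bar x(0)|\le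 Ce^{-ct}$ for all $t\ge0$ and all $i$. -/

import Mathlib

open Filter Topology
open scoped Matrix

noncomputable section

/-- A weighted digraph on the agents `0, …, m-1`: `a i j > 0` is the weight of the link from agent
`j` to agent `i` (then `j` is an in-neighbour of `i`), and `a i j = 0` means there is no such link. -/
structure WeightedDigraph (m : ℕ) where
  a : Matrix (Fin m) (Fin m) ℝ
  nonneg : ∀ i j, 0 ≤ a i j
  diag_zero : ∀ i, a i i = 0

namespace WeightedDigraph

variable {m : ℕ}

/-- The Laplacian `L = A - D`, with `D` the diagonal matrix of weighted in-degrees. -/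
def lap (G : WeightedDigraph m) : Matrix (Fin m) (Fin m) ℝ :=
  G.a - Matrix.diagonal (fun i => ∑ j, G.a i j)

/-- There is a directed path (possibly of length zero) from `i` to `j`. -/
def Reach (G : WeightedDigraph m) (i j : Fin m) : Prop :=
  Relation.ReflTransGen (fun p q => 0 < G.a q p) i j

/-- The digraph has a (directed) spanning tree: there are a root and a parent map such that there is
a link from the parent of each non-root agent to that agent, and following parents leads to the
root. -/
def HasSpanningTree (G : WeightedDigraph m) : Prop :=
  ∃ (root : Fin m) (parent : Fin m → Fin m),
    (∀ i, i ≠ root → 0 < G.a i (parent i)) ∧ ∀ i, ∃ n : ℕ, parent^[n] i = root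

/-- The Laplacian is in Frobenius block upper triangular form with `N + 1` blocks, where `b i` is the
index of the block of agent `i`: blocks are non-empty and consecutive, the blocks are the strongly
connected components, all blocks below the diagonal vanish, and each block row but the last one has
a non-zero block to the right of the diagonal. -/
structure IsFrobeniusForm {N : ℕ} (G : WeightedDigraph m) (b : Fin m → Fin (N + 1)) : Prop where
  mono : Monotone b
  surj : Function.Surjective b
  scc : ∀ i j, b i = b j ↔ G.Reach i j ∧ G.Reach j i
  upper : G.lap.BlockTriangular b
  link : ∀ k, k < Fin.last N → ∃ i j, b i = k ∧ k < b j ∧ G.lap i j ≠ 0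

/-- `ξ` is the positive left null vector, with entries summing to one, of the last diagonal block of
the Laplacian (the block of the root strongly connected component). -/
structure IsRootWeight {N : ℕ} (G : WeightedDigraph m) (b : Fin m → Fin (N + 1))
    (ξ : {p : Fin m // b p = Fin.last N} → ℝ) : Prop where
  pos : ∀ p, 0 < ξ p
  sum_one : ∑ p, ξ p = 1
  null : ξ ᵥ* (G.lap.submatrix Subtype.val Subtype.val :
    Matrix {p : Fin m // b p = Fin.last N} {p : Fin m // b p = Fin.last N} ℝ) = 0

end WeightedDigraph

/-- The data of a run of the multi-agent system.
* `x s i` is the state of agent `i` at time `s`;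
* `t i k` is the `k`-th trigger time of agent `i`, counted from `k = 0`; the value `⊤` means that
  agent `i` has no `k`-th trigger;
* `[0, T)` is the time interval on which the run is defined;
* `rank s` is the order in which agents that trigger at the same instant `s` do so: an agent sees
  the triggers that other agents make at the very instant `s` if their rank is smaller. -/
structure Run (m : ℕ) where
  x : ℝ → Fin m → ℝ
  t : Fin m → ℕ → EReal
  T : EReal
  rank : ℝ → Fin m → ℕ

/-- A condition monitored by an agent: it depends on the agent, the time, the states `z` and the
latest broadcast states `w` of all agents. -/
abbrev AgentTest (m : ℕ) : Type := Fin m → ℝ → (Fin m → ℝ) → (Fin m → ℝ) → Prop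

namespace Run

variable {m : ℕ}

def TriggersAt (S : Run m) (i : Fin m) (s : ℝ) : Prop := ∃ k, S.t i k = (s : EReal)

/-- The largest `k` with `t i k ≤ s`. -/
def counter (S : Run m) (i : Fin m) (s : ℝ) : ℕ := sSup {k | S.t i k ≤ (s : EReal)}

/-- The largest `k` with `t i k < s`. -/
def counterPre (S : Run m) (i : Fin m) (s : ℝ) : ℕ := sSup {k | S.t i k < (s : EReal)}

/-- The broadcast state of agent `i` at time `s`: its state at its latest trigger time `≤ s`. -/
def xhat (S : Run m) (s : ℝ) (i : Fin m) : ℝ := S.x (S.t i (S.counter i s)).toReal i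

/-- The broadcast state of agent `i` just before time `s`. -/
def xhatPre (S : Run m) (s : ℝ) (i : Fin m) : ℝ := S.x (S.t i (S.counterPre i s)).toReal i

/-- The broadcast states at the instant `s` when agent `i`, whose latest trigger is the `k`-th one,
decides whether to trigger at `s`. Its own value is the one of its `k`-th trigger; of the other
agents that trigger at `s`, those of smaller rank have already renewed their value (all of
them, if agent `i` has itself triggered at `s` already). -/
def view (S : Run m) (i : Fin m) (k : ℕ) (s : ℝ) (j : Fin m) : ℝ :=
  open Classical in
  if j = i then S.x (S.t i k).toReal i
  else if S.rank s j < S.rank s i ∨ S.t i k = (s : EReal) then S.xhat s j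
  else S.xhatPre s j

/-- The motion up to time `s`, continued after `s` with broadcast states `w`. -/
def predState (S : Run m) (L : Matrix (Fin m) (Fin m) ℝ) (s : ℝ) (w : Fin m → ℝ) (r : ℝ)
    (p : Fin m) : ℝ :=
  if r ≤ s then S.x r p else S.x s p + (r - s) * (L *ᵥ w) p

/-- The broadcast states before time `s`, continued from `s` on with broadcast states `w`. -/
def predHat (S : Run m) (s : ℝ) (w : Fin m → ℝ) (r : ℝ) : Fin m → ℝ :=
  if r < s then S.xhat r else w

/-- The run solves `x' = L x̂` on `[0, T)`. Broadcast states are piecewise constant and right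
continuous, so the equation is: `x` is continuous and has right derivative `L x̂`. All agents trigger
at time `0`; before `T`, triggers do not accumulate; the run is maximal, i.e. it stops at a finite
`T` only if an agent triggers infinitely often before `T`. -/
structure IsMotion (S : Run m) (L : Matrix (Fin m) (Fin m) ℝ) : Prop where
  T_pos : 0 < S.T
  cont : ContinuousOn S.x {s : ℝ | 0 ≤ s ∧ (s : EReal) < S.T}
  ode : ∀ s : ℝ, 0 ≤ s → (s : EReal) < S.T → ∀ i,
    HasDerivWithinAt (fun r => S.x r i) ((L *ᵥ S.xhat s) i) (Set.Ici s) s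
  start : ∀ i, S.t i 0 = 0
  mono : ∀ i, Monotone (S.t i)
  locFinite : ∀ i, ∀ s : ℝ, (s : EReal) < S.T → ∃ k, (s : EReal) < S.t i k
  maximal : S.T = ⊤ ∨ ∃ i, ∀ k, S.t i k < S.T

/-- The test of agent `i` holds along the run from its `k`-th trigger time on, strictly before
`u`. -/
def HoldsBefore (S : Run m) (test : AgentTest m) (i : Fin m) (k : ℕ) (u : EReal) : Prop :=
  ∀ r : ℝ, S.t i k ≤ (r : EReal) → (r : EReal) < u → test i r (S.x r) (S.xhat r)

/-- The `(k+1)`-st trigger time of agent `i` is the largest `τ ≥ t i k` such that the test holds on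
`[t i k, τ]` as long as agent `i` does not trigger again. It is at least `T` if the test holds on
`[t i k, T)`; in particular it is `⊤` (no further trigger) if `T = ⊤` and the test never fails.
If it is a time `s < T`, then what follows `s` in this comparison is not the actual motion, in
which agent `i` renews its broadcast state at `s`, but the one with the broadcast states
that agent `i` sees when it decides. The supremum is a maximum whenever the latter exists; it
need not exist when broadcast states enter the test, since these jump. -/
def NextByTest (S : Run m) (L : Matrix (Fin m) (Fin m) ℝ) (test : AgentTest m) (i : Fin m)
    (k : ℕ) : Prop :=
  (S.T ≤ S.t i (k + 1) ∧ S.HoldsBefore test i k S.T) ∨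
  ∃ s : ℝ, S.t i (k + 1) = (s : EReal) ∧ (s : EReal) < S.T ∧
    IsLUB {τ : ℝ | S.t i k ≤ (τ : EReal) ∧ ∀ r : ℝ, S.t i k ≤ (r : EReal) → r ≤ τ →
      test i r (S.predState L s (S.view i k s) r) (S.predHat s (S.view i k s) r)} s

/-- Less than `ε i` after its `k`-th trigger, at time `r`, agent `i` receives renewed information
from an in-neighbour. -/
def EarlyInfo (S : Run m) (G : WeightedDigraph m) (ε : Fin m → ℝ) (i : Fin m) (k : ℕ)
    (r : ℝ) : Prop :=
  (S.t i k).toReal < r ∧ r < (S.t i k).toReal + ε i ∧ ∃ j, 0 < G.a i j ∧ S.TriggersAt j r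

/-- The two-step rule: if agent `i` receives renewed information from an in-neighbour, while the test
has not failed and less than `ε i` after its `k`-th trigger, then it triggers at the first such time;
otherwise its next trigger time is the one given by the test. A trigger caused by renewed information
at the same instant comes after (has larger rank than) the trigger that causes it. -/
def NextByTestOrInfo (S : Run m) (G : WeightedDigraph m) (test : AgentTest m) (ε : Fin m → ℝ)
    (i : Fin m) (k : ℕ) : Prop :=
  (∃ s : ℝ, S.t i (k + 1) = (s : EReal) ∧ (s : EReal) < S.T ∧
    (S.t i k).toReal < s ∧ s < (S.t i k).toReal + ε i ∧
    (∃ j, 0 < G.a i j ∧ S.TriggersAt j s ∧ S.rank s j < S.rank s i) ∧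
    S.HoldsBefore test i k s ∧ ∀ r : ℝ, r < s → ¬ S.EarlyInfo G ε i k r) ∨
  (S.NextByTest G.lap test i k ∧
    ∀ r : ℝ, (r : EReal) < min (S.t i (k + 1)) S.T → ¬ S.EarlyInfo G ε i k r)

/-- Each agent has only finitely many triggers in each finite time interval. -/
def ZenoFree (S : Run m) : Prop := ∀ i, ∀ B : ℝ, {k | S.t i k ≤ (B : EReal)}.Finite

/-- All agents converge to the common value `v` exponentially with rate `c`. -/
def ConsensusWithRate (S : Run m) (c v : ℝ) : Prop :=
  ∃ C : ℝ, ∀ i, ∀ s : ℝ, 0 ≤ s → |S.x s i - v| ≤ C * Real.exp (-c * s)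

/-- The weighted average of the initial states over the root strongly connected component. -/
def rootAverage {N : ℕ} (S : Run m) {b : Fin m → Fin (N + 1)}
    (ξ : {p : Fin m // b p = Fin.last N} → ℝ) : ℝ := ∑ p, ξ p * S.x 0 p.val

end Run

variable {m : ℕ}

/-- `|x_i(t_k) - x_i| ≤ √(γ_i / (4 |L_ii|) q_i)`, `q_i = ∑_j L_ij (x_j - x_i)²`. -/
def stateTest (L : Matrix (Fin m) (Fin m) ℝ) (γ : Fin m → ℝ) : AgentTest m := fun i _ z w =>
  |w i - z i| ≤ √(γ i / (4 * |L i i|) * ∑ j, L i j * (z j - z i) ^ 2)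

/-- `|x_i(t_k) - x_i| ≤ φ_i exp (-α_i r)` at time `r`. -/
def decayTest (φ α : Fin m → ℝ) : AgentTest m := fun i r z w =>
  |w i - z i| ≤ φ i * Real.exp (-α i * r)

/-- `|x_i(t_k) - x_i| ≤ √(γ_i / (4 |L_ii|) q̂_i)`, `q̂_i = ∑_j L_ij (x̂_j - x̂_i)²`. -/
def broadcastTest (L : Matrix (Fin m) (Fin m) ℝ) (γ : Fin m → ℝ) : AgentTest m := fun i _ z w =>
  |w i - z i| ≤ √(γ i / (4 * |L i i|) * ∑ j, L i j * (w j - w i) ^ 2)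

/-- A run in which every agent triggers by comparing its error with the current states of its
in-neighbours. -/
structure IsStateRun (G : WeightedDigraph m) (γ : Fin m → ℝ) (S : Run m) : Prop where
  motion : S.IsMotion G.lap
  rule : ∀ i k, S.t i k < S.T → S.NextByTest G.lap (stateTest G.lap γ) i k

/-- A run in which every agent triggers by comparing its error with a decaying exponential. -/
structure IsDecayRun (G : WeightedDigraph m) (φ α : Fin m → ℝ) (S : Run m) : Prop where
  motion : S.IsMotion G.lap
  rule : ∀ i k, S.t i k < S.T → S.NextByTest G.lap (decayTest φ α) i k

/-- A run in which every agent triggers by the two-step rule based on broadcast states. -/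
structure IsBroadcastRun (G : WeightedDigraph m) (γ ε : Fin m → ℝ) (S : Run m) : Prop where
  motion : S.IsMotion G.lap
  rule : ∀ i k, S.t i k < S.T → S.NextByTestOrInfo G (broadcastTest G.lap γ) ε i k

end

/-! Put `y = x - x̄(0)` and `e = x̂ - x`. The root weight, extended by zero to a vector `ζ`,
satisfies `ζ L = 0`. Hence the `ζ`-mean of the states is conserved, which identifies the limit.

Convergence comes from the Lyapunov function `∑ w_p y_p²` with `w = K ζ + η`. Completing squares
link by link (`sum_mul_lap_le_state`, `sum_mul_lap_le_broadcast`) bounds half its derivative by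
minus a quarter of the disagreement energy, plus in-degree times squared errors, plus terms carrying
`w L`. The factor `γ/4` in Rules 1 and 3 makes the errors smaller than the energy. The `ζ` part then
dissipates the root energy, which controls the root states by `IsRootWeight.poincare`. The weight
`η` of `exists_dissipative_weight` has `η L = -1` outside the root component, which gives decay
there; its nonnegative contribution on the root component is paid for by a large `K`. Under Rule 2
the threshold acts as an exponentially small forcing. All this is done on `[0, T)`, without knowing
that `T = ∞`.

By maximality, `T = ∞` follows once no agent triggers infinitely often before a finite `T`. Rule 1
assumes this. Under Rule 2 the speeds are bounded and the threshold is bounded below on `[0, T)`, so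
the gaps between triggers are bounded below. Under Rule 3 a trigger less than `ε_i` after the
previous one is caused by another trigger at the same instant with smaller rank
(`long_gap_or_cause`). Following causes back ends at a trigger after a long gap, and there are
finitely many of those before `T`. -/

noncomputable section

/-! ### Positive left null vectors of irreducible matrices with zero row sums -/

/-- If every row of a matrix with nonnegative off-diagonal entries sums to zero, then the entrywise
absolute value of a left null vector is again a left null vector. -/
theorem Matrix.abs_vecMul_eq_zero {ι : Type*} [Fintype ι] (M : Matrix ι ι ℝ)
    (off : ∀ p q, p ≠ q → 0 ≤ M p q) (row : ∀ p, ∑ q, M p q = 0) (ξ : ι → ℝ)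
    (h : ξ ᵥ* M = 0) : (fun p => |ξ p|) ᵥ* M = 0 := by
  classical
  have key : ∀ q, 0 ≤ ((fun p => |ξ p|) ᵥ* M) q := by
    intro q
    have hq : ∑ p, ξ p * M p q = 0 := congrFun h q
    change 0 ≤ ∑ p, |ξ p| * M p q
    rw [← Finset.add_sum_erase _ _ (Finset.mem_univ q)] at hq ⊢
    have hd : M q q ≤ 0 := by
      have := row q
      rw [← Finset.add_sum_erase _ _ (Finset.mem_univ q)] at this
      have h2 : 0 ≤ ∑ p ∈ Finset.univ.erase q, M q p :=
        Finset.sum_nonneg fun p hp => off _ _ (Finset.ne_of_mem_erase hp).symm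
      linarith
    -- The null equation at column `q` balances the diagonal term against the others; the triangle
    -- inequality then makes every column of `|ξ| M` nonnegative, while the columns add up to zero.
    have h1 : |ξ q| * M q q = -|∑ p ∈ Finset.univ.erase q, ξ p * M p q| := by
      rw [← neg_eq_of_add_eq_zero_right hq, abs_neg, abs_mul, abs_of_nonpos hd]
      ring
    have h2 : |∑ p ∈ Finset.univ.erase q, ξ p * M p q| ≤
        ∑ p ∈ Finset.univ.erase q, |ξ p| * M p q := by
      refine (Finset.abs_sum_le_sum_abs _ _).trans (Finset.sum_le_sum fun p hp => ?_)
      rw [abs_mul, abs_of_nonneg (off p q (Finset.ne_of_mem_erase hp))]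
    linarith
  have tot : ∑ q, ((fun p => |ξ p|) ᵥ* M) q = 0 := by
    change ∑ q, ∑ p, |ξ p| * M p q = 0
    rw [Finset.sum_comm]
    simp [← Finset.mul_sum, row]
  funext q
  exact (Finset.sum_eq_zero_iff_of_nonneg fun q _ => key q).1 tot q (Finset.mem_univ q)

/-- A nonnegative left null vector of an irreducible matrix that vanishes at one index is zero. -/
theorem Matrix.eq_zero_of_vecMul_eq_zero_of_apply_eq_zero {ι : Type*} [Fintype ι] (M : Matrix ι ι ℝ)
    (off : ∀ p q, p ≠ q → 0 ≤ M p q)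
    (conn : ∀ p q, Relation.ReflTransGen (fun p q => 0 < M q p) p q) (ξ : ι → ℝ)
    (h : ξ ᵥ* M = 0) (h0 : ∀ p, 0 ≤ ξ p) (q : ι) (hq : ξ q = 0) (p : ι) : ξ p = 0 := by
  induction conn q p with
  | refl => exact hq
  | @tail p r _ hpr ih =>
    have hp : ∑ r, ξ r * M r p = 0 := congrFun h p
    -- Zeros spread along links: if `ξ p = 0`, column `p` is a vanishing sum of nonnegative terms.
    have hn : ∀ r ∈ Finset.univ, 0 ≤ ξ r * M r p := by
      intro r _
      by_cases hrp : r = p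
      · rw [hrp, ih, zero_mul]
      · exact mul_nonneg (h0 r) (off r p hrp)
    have := (Finset.sum_eq_zero_iff_of_nonneg hn).1 hp r (Finset.mem_univ r)
    exact (mul_eq_zero.1 this).resolve_right hpr.ne'

/-- An irreducible matrix with nonnegative off-diagonal entries and zero row sums has exactly one
positive normalized left null vector. -/
theorem Matrix.existsUnique_pos_vecMul_eq_zero {ι : Type*} [Fintype ι] [Nonempty ι]
    (M : Matrix ι ι ℝ) (off : ∀ p q, p ≠ q → 0 ≤ M p q) (row : ∀ p, ∑ q, M p q = 0)
    (conn : ∀ p q, Relation.ReflTransGen (fun p q => 0 < M q p) p q) :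
    ∃! ξ : ι → ℝ, (∀ p, 0 < ξ p) ∧ ∑ p, ξ p = 1 ∧ ξ ᵥ* M = 0 := by
  classical
  have pos : ∀ ξ : ι → ℝ, ξ ≠ 0 → ξ ᵥ* M = 0 → ∀ p, 0 < |ξ p| := by
    intro ξ hne h p
    refine abs_pos.2 fun hp => hne (funext fun q => ?_)
    exact abs_eq_zero.1 (M.eq_zero_of_vecMul_eq_zero_of_apply_eq_zero off conn _ (M.abs_vecMul_eq_zero off row ξ h)
      (fun p => abs_nonneg _) p (abs_eq_zero.2 hp) q)
  obtain ⟨ξ, hne, h⟩ : ∃ ξ : ι → ℝ, ξ ≠ 0 ∧ ξ ᵥ* M = 0 := by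
    rw [Matrix.exists_vecMul_eq_zero_iff, ← Matrix.exists_mulVec_eq_zero_iff]
    refine ⟨1, one_ne_zero, ?_⟩
    funext p
    simpa [Matrix.mulVec, dotProduct] using row p
  have hp := pos ξ hne h
  have hs : 0 < ∑ p, |ξ p| := Finset.sum_pos (fun p _ => hp p) Finset.univ_nonempty
  refine ⟨(∑ p, |ξ p|)⁻¹ • fun p => |ξ p|, ⟨fun p => ?_, ?_, ?_⟩, ?_⟩
  · exact mul_pos (inv_pos.2 hs) (hp p)
  · simp only [Pi.smul_apply, smul_eq_mul, ← Finset.mul_sum]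
    exact inv_mul_cancel₀ hs.ne'
  · rw [Matrix.smul_vecMul, M.abs_vecMul_eq_zero off row ξ h, smul_zero]
  · suffices H : ∀ μ ν : ι → ℝ, (∑ p, μ p = 1 ∧ μ ᵥ* M = 0) → (∑ p, ν p = 1 ∧ ν ᵥ* M = 0) →
        μ = ν by
      intro ν hν
      refine H _ _ hν.2 ⟨?_, ?_⟩
      · simp only [Pi.smul_apply, smul_eq_mul, ← Finset.mul_sum]
        exact inv_mul_cancel₀ hs.ne'
      · rw [Matrix.smul_vecMul, M.abs_vecMul_eq_zero off row ξ h, smul_zero]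
    intro μ ν hμ hν
    by_contra hμν
    have hd : (μ - ν) ᵥ* M = 0 := by rw [Matrix.sub_vecMul, hμ.2, hν.2, sub_zero]
    have hsum : ∑ p, (μ - ν) p = 0 := by simp [hμ.1, hν.1]
    have hpos := pos _ (sub_ne_zero.2 hμν) hd
    -- Uniqueness: the difference has sum zero, so it is nonpositive somewhere. There its doubled
    -- positive part `|d| + d`, again a nonnegative null vector, vanishes, hence it vanishes
    -- everywhere.
    have hplus : ((fun p => |(μ - ν) p|) + (μ - ν)) ᵥ* M = 0 := by
      rw [Matrix.add_vecMul, M.abs_vecMul_eq_zero off row _ hd, hd, add_zero]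
    have hplus0 : ∀ p, 0 ≤ ((fun p => |(μ - ν) p|) + (μ - ν)) p := fun p => by
      have := neg_abs_le ((μ - ν) p)
      simp only [Pi.add_apply]
      linarith
    by_cases hq : ∃ q, (μ - ν) q ≤ 0
    · obtain ⟨q, hq⟩ := hq
      have hall := M.eq_zero_of_vecMul_eq_zero_of_apply_eq_zero off conn _ hplus hplus0 q (by
        simp only [Pi.add_apply, abs_of_nonpos hq]; ring)
      have : ∑ p, |(μ - ν) p| = 0 := by
        have h2 : ∑ p, ((fun p => |(μ - ν) p|) + (μ - ν)) p = 0 :=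
          Finset.sum_eq_zero fun p _ => hall p
        simp only [Pi.add_apply, Finset.sum_add_distrib] at h2
        linarith
      have := Finset.sum_pos (fun p _ => hpos p) (Finset.univ_nonempty (α := ι))
      linarith
    · push Not at hq
      have := Finset.sum_pos (fun p _ => hq p) (Finset.univ_nonempty (α := ι))
      linarith

/-! ### Laplacian, disagreement and link-by-link dissipation estimates -/

namespace WeightedDigraph

variable {m N : ℕ} (G : WeightedDigraph m)

/-- The weighted in-degree. -/
def inDegree (i : Fin m) : ℝ := ∑ j, G.a i j

/-- The weighted sum of the squared differences between the value at an agent and the values at its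
in-neighbours. -/
def disagreement (z : Fin m → ℝ) (i : Fin m) : ℝ := ∑ j, G.a i j * (z j - z i) ^ 2

/-- The sum of the disagreements, weighted by `u`. -/
def energy (u z : Fin m → ℝ) : ℝ := ∑ i, u i * G.disagreement z i

theorem inDegree_nonneg (i : Fin m) : 0 ≤ G.inDegree i :=
  Finset.sum_nonneg fun j _ => G.nonneg i j

theorem disagreement_nonneg (z : Fin m → ℝ) (i : Fin m) : 0 ≤ G.disagreement z i :=
  Finset.sum_nonneg fun j _ => mul_nonneg (G.nonneg i j) (sq_nonneg _)

theorem lap_diag (i : Fin m) : G.lap i i = -G.inDegree i := by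
  simp [lap, inDegree, G.diag_zero]

theorem lap_of_ne {i j : Fin m} (h : i ≠ j) : G.lap i j = G.a i j := by
  simp [lap, h]

theorem abs_lap_diag (i : Fin m) : |G.lap i i| = G.inDegree i := by
  rw [lap_diag, abs_neg, abs_of_nonneg (G.inDegree_nonneg i)]

theorem lap_row_sum (i : Fin m) : ∑ j, G.lap i j = 0 := by
  simp [lap, Finset.sum_sub_distrib, Matrix.diagonal_apply]

theorem lap_sum_sq (z : Fin m → ℝ) (i : Fin m) :
    ∑ j, G.lap i j * (z j - z i) ^ 2 = G.disagreement z i := by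
  refine Finset.sum_congr rfl fun j _ => ?_
  by_cases h : i = j
  · simp [h]
  · rw [G.lap_of_ne h]

theorem lap_mulVec (z : Fin m → ℝ) (i : Fin m) :
    (G.lap *ᵥ z) i = ∑ j, G.a i j * (z j - z i) := by
  have h : (G.lap *ᵥ z) i = ∑ j, G.lap i j * (z j - z i) := by
    simp only [mul_sub, Finset.sum_sub_distrib, ← Finset.sum_mul, G.lap_row_sum, zero_mul, sub_zero]
    rfl
  rw [h]
  refine Finset.sum_congr rfl fun j _ => ?_
  by_cases h : i = j
  · simp [h]
  · rw [G.lap_of_ne h]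

/-- Turns differences `g q - g p` summed over links into a term carrying `u L`, which disappears
when `u` is a left null vector. -/
theorem sum_vecMul_lap (u g : Fin m → ℝ) :
    ∑ q, (u ᵥ* G.lap) q * g q = ∑ p, ∑ q, u p * (G.a p q * (g q - g p)) := by
  have h : ∑ q, (u ᵥ* G.lap) q * g q = u ⬝ᵥ (G.lap *ᵥ g) := by
    rw [Matrix.dotProduct_mulVec]; rfl
  rw [h]
  simp only [dotProduct, G.lap_mulVec, Finset.mul_sum]

theorem energy_nonneg {u : Fin m → ℝ} (hu : ∀ i, 0 ≤ u i) (z : Fin m → ℝ) : 0 ≤ G.energy u z :=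
  Finset.sum_nonneg fun i _ => mul_nonneg (hu i) (G.disagreement_nonneg z i)

theorem mul_disagreement_le_energy {u : Fin m → ℝ} (hu : ∀ i, 0 ≤ u i) (z : Fin m → ℝ)
    (i : Fin m) : u i * G.disagreement z i ≤ G.energy u z :=
  Finset.single_le_sum (f := fun i => u i * G.disagreement z i)
    (fun i _ => mul_nonneg (hu i) (G.disagreement_nonneg z i)) (Finset.mem_univ i)

/-- Dissipation estimate in terms of the states. -/
theorem sum_mul_lap_le_state (u y e : Fin m → ℝ) (hu : ∀ i, 0 ≤ u i) :
    ∑ p, u p * (y p * (G.lap *ᵥ (y + e)) p) ≤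
      -(1 / 4) * G.energy u y +
        ∑ q, (u ᵥ* G.lap) q * (1 / 2 * y q ^ 2 + y q * e q + e q ^ 2) +
        ∑ p, u p * (G.inDegree p * e p ^ 2) := by
  rw [G.sum_vecMul_lap u fun q => 1 / 2 * y q ^ 2 + y q * e q + e q ^ 2]
  simp only [energy, disagreement, inDegree, G.lap_mulVec, Finset.mul_sum, Finset.sum_mul,
    ← Finset.sum_add_distrib]
  refine Finset.sum_le_sum fun p _ => Finset.sum_le_sum fun q _ => ?_
  -- On each link the two sides differ by exactly this weighted square.
  have h := mul_nonneg (mul_nonneg (hu p) (G.nonneg p q))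
    (sq_nonneg (1 / 2 * (y q - y p) + e q))
  simp only [Pi.add_apply]
  linarith

/-- Dissipation estimate in terms of the broadcast states `y + e`. -/
theorem sum_mul_lap_le_broadcast (u y e : Fin m → ℝ) (hu : ∀ i, 0 ≤ u i) :
    ∑ p, u p * (y p * (G.lap *ᵥ (y + e)) p) ≤
      -(1 / 4) * G.energy u (y + e) +
        ∑ q, (u ᵥ* G.lap) q * (1 / 2 * (y + e) q ^ 2) +
        ∑ p, u p * (G.inDegree p * e p ^ 2) := by
  rw [G.sum_vecMul_lap u fun q => 1 / 2 * (y + e) q ^ 2]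
  simp only [energy, disagreement, inDegree, G.lap_mulVec, Finset.mul_sum, Finset.sum_mul,
    ← Finset.sum_add_distrib]
  refine Finset.sum_le_sum fun p _ => Finset.sum_le_sum fun q _ => ?_
  have h := mul_nonneg (mul_nonneg (hu p) (G.nonneg p q))
    (sq_nonneg (1 / 2 * ((y + e) q - (y + e) p) + e p))
  simp only [Pi.add_apply] at h ⊢
  linarith

end WeightedDigraph

end

/-! ### Structure of the root component and the weights used for the Lyapunov function -/

noncomputable section

theorem exists_pos_forall_le {ι : Type*} [Finite ι] (f : ι → ℝ) (hf : ∀ i, 0 < f i) :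
    ∃ δ, 0 < δ ∧ ∀ i, δ ≤ f i := by
  cases isEmpty_or_nonempty ι
  · exact ⟨1, one_pos, fun i => isEmptyElim i⟩
  · obtain ⟨i, hi⟩ := Finite.exists_min f
    exact ⟨f i, hf i, hi⟩

theorem exists_nonneg_forall_le {ι : Type*} [Finite ι] (f : ι → ℝ) : ∃ C, 0 ≤ C ∧ ∀ i, f i ≤ C := by
  obtain ⟨C, hC⟩ := (Set.finite_range f).bddAbove
  exact ⟨max C 0, le_max_right _ _, fun i => (hC ⟨i, rfl⟩).trans (le_max_left _ _)⟩

namespace WeightedDigraph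

variable {m N : ℕ} {G : WeightedDigraph m} {b : Fin m → Fin (N + 1)}

theorem IsFrobeniusForm.root_of_link (hb : G.IsFrobeniusForm b) {p q : Fin m}
    (hp : b p = Fin.last N) (h : 0 < G.a p q) : b q = Fin.last N := by
  by_contra hq
  have hlt : b q < b p := by rw [hp]; exact Fin.lt_last_iff_ne_last.2 hq
  have := hb.upper hlt
  rw [G.lap_of_ne (fun e => hlt.ne (by rw [e]))] at this
  exact h.ne' this

theorem IsFrobeniusForm.root_of_reach (hb : G.IsFrobeniusForm b) {p q : Fin m}
    (h : G.Reach q p) (hp : b p = Fin.last N) : b q = Fin.last N := by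
  induction h using Relation.ReflTransGen.head_induction_on with
  | refl => exact hp
  | head h _ ih => exact hb.root_of_link ih h

/-- No link enters the last block from outside. As the tree root reaches an agent of that block, it
must itself lie there. -/
theorem IsFrobeniusForm.exists_root_reach (hb : G.IsFrobeniusForm b) (hG : G.HasSpanningTree) :
    ∃ r, b r = Fin.last N ∧ ∀ p, G.Reach r p := by
  obtain ⟨r, parent, h1, h2⟩ := hG
  have reach : ∀ p, G.Reach r p := by
    intro p
    obtain ⟨n, hn⟩ := h2 p
    induction n generalizing p with
    | zero => rw [Function.iterate_zero, id] at hn; rw [hn]; exact Relation.ReflTransGen.refl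
    | succ n ih =>
      by_cases hp : p = r
      · rw [hp]; exact Relation.ReflTransGen.refl
      · exact Relation.ReflTransGen.tail (ih (parent p) hn) (h1 p hp)
  obtain ⟨p, hp⟩ := hb.surj (Fin.last N)
  exact ⟨r, hb.root_of_reach (reach p) hp, reach⟩

theorem IsFrobeniusForm.existsUnique_rootWeight (hb : G.IsFrobeniusForm b) :
    ∃! ξ : {p : Fin m // b p = Fin.last N} → ℝ, G.IsRootWeight b ξ := by
  have : Nonempty {p : Fin m // b p = Fin.last N} :=
    let ⟨p, hp⟩ := hb.surj (Fin.last N); ⟨⟨p, hp⟩⟩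
  have zero : ∀ p q : Fin m, b p = Fin.last N → b q ≠ Fin.last N → G.lap p q = 0 :=
    fun p q hp hq => hb.upper (by rw [hp]; exact Fin.lt_last_iff_ne_last.2 hq)
  obtain ⟨ξ, hξ, huniq⟩ := Matrix.existsUnique_pos_vecMul_eq_zero
    (G.lap.submatrix Subtype.val Subtype.val :
      Matrix {p : Fin m // b p = Fin.last N} {p : Fin m // b p = Fin.last N} ℝ)
    (fun p q hpq => by
      simpa [G.lap_of_ne (fun h => hpq (Subtype.ext h))] using G.nonneg p q)
    (fun p => by
      have h := G.lap_row_sum p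
      rw [← Finset.sum_filter_add_sum_filter_not Finset.univ (fun q => b q = Fin.last N),
        Finset.sum_eq_zero (s := Finset.univ.filter fun q => ¬ b q = Fin.last N)
          (fun q hq => zero p q p.2 (by simpa using hq)), add_zero] at h
      rw [← h, Finset.sum_subtype _ (p := fun q => b q = Fin.last N) (by simp)]
      rfl)
    (fun p q => by
      -- A path ending in the root component stays in it, so strong connectivity passes to the
      -- diagonal block.
      have key : ∀ q : Fin m, G.Reach p q → ∀ hq : b q = Fin.last N,
          Relation.ReflTransGen (fun p q : {p : Fin m // b p = Fin.last N} =>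
            0 < (G.lap.submatrix Subtype.val Subtype.val : Matrix _ _ ℝ) q p) p ⟨q, hq⟩ := by
        intro q h
        induction h with
        | refl => intro _; exact Relation.ReflTransGen.refl
        | @tail r s _ hrs ih =>
          intro hs
          refine Relation.ReflTransGen.tail (ih (hb.root_of_link hs hrs)) ?_
          have hne : s ≠ r := fun e => by rw [e, G.diag_zero] at hrs; exact lt_irrefl _ hrs
          simpa [G.lap_of_ne hne] using hrs
      exact key q ((hb.scc p q).1 (p.2.trans q.2.symm)).1 q.2)
  exact ⟨ξ, ⟨hξ.1, hξ.2.1, hξ.2.2⟩, fun ν hν => huniq ν ⟨hν.pos, hν.sum_one, hν.null⟩⟩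

/-- The root weight, extended by zero to all agents. -/
def extendRoot (b : Fin m → Fin (N + 1)) (ξ : {p : Fin m // b p = Fin.last N} → ℝ) (p : Fin m) :
    ℝ := if h : b p = Fin.last N then ξ ⟨p, h⟩ else 0

theorem sum_extendRoot_mul (ξ : {p : Fin m // b p = Fin.last N} → ℝ) (z : Fin m → ℝ) :
    ∑ p, extendRoot b ξ p * z p = ∑ p, ξ p * z p.val := by
  rw [← Finset.sum_filter_add_sum_filter_not Finset.univ (fun q => b q = Fin.last N),
    Finset.sum_eq_zero (s := Finset.univ.filter fun q => ¬ b q = Fin.last N)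
      (fun q hq => by simp [extendRoot, (Finset.mem_filter.1 hq).2]), add_zero,
    Finset.sum_subtype _ (p := fun q => b q = Fin.last N) (by simp)]
  exact Finset.sum_congr rfl fun p _ => by simp [extendRoot, p.2]

section RootWeight

variable {ξ : {p : Fin m // b p = Fin.last N} → ℝ}

theorem IsRootWeight.extend_pos (hξ : G.IsRootWeight b ξ) {p : Fin m} (hp : b p = Fin.last N) :
    0 < extendRoot b ξ p := by
  simp only [extendRoot, hp, dif_pos]; exact hξ.pos _

theorem IsRootWeight.extend_nonneg (hξ : G.IsRootWeight b ξ) (p : Fin m) :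
    0 ≤ extendRoot b ξ p := by
  by_cases hp : b p = Fin.last N
  · exact (hξ.extend_pos hp).le
  · simp [extendRoot, hp]

theorem IsRootWeight.sum_extend (hξ : G.IsRootWeight b ξ) : ∑ p, extendRoot b ξ p = 1 := by
  simpa [hξ.sum_one] using sum_extendRoot_mul ξ (fun _ => 1)

theorem IsRootWeight.extend_vecMul (hξ : G.IsRootWeight b ξ) (hb : G.IsFrobeniusForm b) :
    extendRoot b ξ ᵥ* G.lap = 0 := by
  funext q
  change ∑ p, extendRoot b ξ p * G.lap p q = 0
  rw [sum_extendRoot_mul]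
  by_cases hq : b q = Fin.last N
  · exact congrFun hξ.null ⟨q, hq⟩
  · refine Finset.sum_eq_zero fun p _ => ?_
    rw [hb.upper (by rw [p.2]; exact Fin.lt_last_iff_ne_last.2 hq), mul_zero]

/-- A Poincaré inequality on the root component. -/
theorem IsRootWeight.poincare (hξ : G.IsRootWeight b ξ) (hb : G.IsFrobeniusForm b) :
    ∃ C, 0 ≤ C ∧ ∀ (z : Fin m → ℝ) (q : Fin m), b q = Fin.last N →
      z q ^ 2 ≤ C * (G.energy (extendRoot b ξ) z + (∑ p, extendRoot b ξ p * z p) ^ 2) := by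
  have step : ∀ p q : Fin m, G.Reach p q → b q = Fin.last N → ∃ C, ∀ z : Fin m → ℝ,
      (z q - z p) ^ 2 ≤ C * G.energy (extendRoot b ξ) z := by
    intro p q h
    induction h with
    | refl => exact fun _ => ⟨0, fun z => by simp⟩
    | @tail q r _ hqr ih =>
      intro hr
      obtain ⟨C, hC⟩ := ih (hb.root_of_link hr hqr)
      have hpos : 0 < extendRoot b ξ r * G.a r q := mul_pos (hξ.extend_pos hr) hqr
      -- The square of a sum is at most twice the sum of the squares: the old path costs `C`, the
      -- new link the inverse of its weight in the energy.
      refine ⟨2 * C + 2 * (extendRoot b ξ r * G.a r q)⁻¹, fun z => ?_⟩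
      have h1 : extendRoot b ξ r * G.a r q * (z q - z r) ^ 2 ≤ G.energy (extendRoot b ξ) z := by
        refine le_trans ?_ (G.mul_disagreement_le_energy hξ.extend_nonneg z r)
        rw [mul_assoc]
        exact mul_le_mul_of_nonneg_left (Finset.single_le_sum
          (f := fun j => G.a r j * (z j - z r) ^ 2)
          (fun j _ => mul_nonneg (G.nonneg r j) (sq_nonneg _)) (Finset.mem_univ q))
          (hξ.extend_nonneg r)
      have h2 : (z q - z r) ^ 2 ≤
          (extendRoot b ξ r * G.a r q)⁻¹ * G.energy (extendRoot b ξ) z := by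
        rwa [inv_mul_eq_div, le_div_iff₀' hpos]
      nlinarith [hC z, sq_nonneg ((z q - z p) - (z r - z q))]
  have step' : ∀ x : Fin m × Fin m, ∃ C, b x.1 = Fin.last N → b x.2 = Fin.last N →
      ∀ z : Fin m → ℝ, (z x.2 - z x.1) ^ 2 ≤ C * G.energy (extendRoot b ξ) z := by
    intro x
    by_cases h : b x.1 = Fin.last N ∧ b x.2 = Fin.last N
    · obtain ⟨C, hC⟩ := step x.1 x.2 ((hb.scc _ _).1 (h.1.trans h.2.symm)).1 h.2
      exact ⟨C, fun _ _ => hC⟩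
    · exact ⟨0, fun h1 h2 => absurd ⟨h1, h2⟩ h⟩
  choose C hC using step'
  obtain ⟨D, hD0, hD⟩ := exists_nonneg_forall_le C
  refine ⟨2 * D + 2, by positivity, fun z q hq => ?_⟩
  have hE := G.energy_nonneg hξ.extend_nonneg z
  set E := G.energy (extendRoot b ξ) z
  have h1 : ∀ p, |extendRoot b ξ p * (z q - z p)| ≤ extendRoot b ξ p * √(D * E) := by
    intro p
    rw [abs_mul, abs_of_nonneg (hξ.extend_nonneg p)]
    by_cases hp : b p = Fin.last N
    · refine mul_le_mul_of_nonneg_left (Real.abs_le_sqrt ?_) (hξ.extend_nonneg p)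
      exact (hC (p, q) hp hq z).trans (mul_le_mul_of_nonneg_right (hD _) hE)
    · simp [extendRoot, hp]
  -- Since the weights sum to one, `z q` is its mean deviation from the other values plus the
  -- weighted mean.
  have h2 : z q = ∑ p, extendRoot b ξ p * (z q - z p) + ∑ p, extendRoot b ξ p * z p := by
    simp only [mul_sub, Finset.sum_sub_distrib, ← Finset.sum_mul, hξ.sum_extend]
    ring
  have h3 : |∑ p, extendRoot b ξ p * (z q - z p)| ≤ √(D * E) := by
    refine (Finset.abs_sum_le_sum_abs _ _).trans ((Finset.sum_le_sum fun p _ => h1 p).trans ?_)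
    rw [← Finset.sum_mul, hξ.sum_extend, one_mul]
  have h4 : (∑ p, extendRoot b ξ p * (z q - z p)) ^ 2 ≤ D * E := by
    rw [← sq_abs]
    calc _ ≤ √(D * E) ^ 2 := pow_le_pow_left₀ (abs_nonneg _) h3 2
      _ = _ := Real.sq_sqrt (mul_nonneg hD0 hE)
  set X := ∑ p, extendRoot b ξ p * (z q - z p)
  set Y := ∑ p, extendRoot b ξ p * z p
  rw [h2]
  nlinarith [sq_nonneg (X - Y), mul_nonneg hD0 (sq_nonneg Y)]

end RootWeight

/-- A minimum principle: a function that is nonnegative on the root component and superharmonic at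
the other agents is nonnegative. -/
theorem IsFrobeniusForm.nonneg_of_superharmonic (hb : G.IsFrobeniusForm b)
    (hG : G.HasSpanningTree) (z : Fin m → ℝ) (hz : ∀ p, b p = Fin.last N → 0 ≤ z p)
    (h : ∀ p, b p ≠ Fin.last N → (G.lap *ᵥ z) p ≤ 0) (p : Fin m) : 0 ≤ z p := by
  have : Nonempty (Fin m) := ⟨p⟩
  obtain ⟨q, hq⟩ := Finite.exists_min z
  by_contra! hp
  obtain ⟨r, hr, hreach⟩ := hb.exists_root_reach hG
  -- Starting from a negative minimum, minimality propagates backwards along links and reaches the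
  -- tree root, where `z` is nonnegative.
  have key : ∀ s, G.Reach s q → z s ≤ z q := by
    intro s hs
    induction hs using Relation.ReflTransGen.head_induction_on with
    | refl => exact le_rfl
    | @head s t hst _ ih =>
      have ht : b t ≠ Fin.last N := fun ht => by linarith [hz t ht, hq p]
      have h1 := h t ht
      rw [G.lap_mulVec] at h1
      have hn : ∀ j ∈ Finset.univ, 0 ≤ G.a t j * (z j - z t) := fun j _ =>
        mul_nonneg (G.nonneg t j) (by linarith [hq j])
      have h2 := Finset.single_le_sum hn (Finset.mem_univ s)
      have h3 : z s - z t ≤ 0 := nonpos_of_mul_nonpos_right (h2.trans h1) hst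
      linarith
  linarith [hz r hr, hq p, key r (hreach q)]

/-- There is a weight supported on the agents outside the root component, and positive there, for
which the Laplacian is strictly dissipative outside the root component. -/
theorem IsFrobeniusForm.exists_dissipative_weight (hb : G.IsFrobeniusForm b)
    (hG : G.HasSpanningTree) : ∃ η : Fin m → ℝ, (∀ p, 0 ≤ η p) ∧
      (∀ p, b p ≠ Fin.last N → 0 < η p) ∧ (∀ q, b q ≠ Fin.last N → (η ᵥ* G.lap) q = -1) ∧
      ∀ q, b q = Fin.last N → 0 ≤ (η ᵥ* G.lap) q := by
  classical
  -- `B` encodes the Dirichlet problem with data on the root component. By the minimum principle it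
  -- is inverse-positive, and `η` is a truncated row solution of `θ B = v`.
  let B : Matrix (Fin m) (Fin m) ℝ := fun p q =>
    if b p = Fin.last N then (1 : Matrix (Fin m) (Fin m) ℝ) p q else -G.lap p q
  have Broot : ∀ (z : Fin m → ℝ) p, b p = Fin.last N → (B *ᵥ z) p = z p := by
    intro z p hp
    change ∑ q, B p q * z q = z p
    simp [B, hp, Matrix.one_apply]
  have Bother : ∀ (z : Fin m → ℝ) p, b p ≠ Fin.last N → (B *ᵥ z) p = -(G.lap *ᵥ z) p := by
    intro z p hp
    change ∑ q, B p q * z q = -∑ q, G.lap p q * z q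
    simp [B, hp]
  have mono : ∀ z : Fin m → ℝ, (∀ p, 0 ≤ (B *ᵥ z) p) → ∀ p, 0 ≤ z p := by
    intro z hz p
    refine hb.nonneg_of_superharmonic hG z (fun p hp => ?_) (fun p hp => ?_) p
    · rw [← Broot z p hp]; exact hz p
    · have := hz p
      rw [Bother z p hp] at this
      linarith
  have hdet : IsUnit B.det := by
    rw [isUnit_iff_ne_zero]
    intro h0
    obtain ⟨z, hz, hBz⟩ := Matrix.exists_mulVec_eq_zero_iff.2 h0
    refine hz (funext fun p => le_antisymm ?_ (mono z (fun p => by rw [hBz]; exact le_rfl) p))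
    have := mono (-z) (fun p => by rw [Matrix.mulVec_neg, hBz]; simp) p
    simp only [Pi.neg_apply] at this
    simp only [Pi.zero_apply]
    linarith
  have hinv : ∀ p q, 0 ≤ B⁻¹ p q := by
    intro p q
    have := mono (B⁻¹ *ᵥ Pi.single q 1) (fun r => by
      rw [Matrix.mulVec_mulVec, Matrix.mul_nonsing_inv B hdet, Matrix.one_mulVec]
      by_cases h : r = q
      · rw [h]; simp
      · simp [h]) p
    simpa using this
  let v : Fin m → ℝ := fun p => if b p = Fin.last N then 0 else 1
  let θ : Fin m → ℝ := v ᵥ* B⁻¹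
  have hθ : θ ᵥ* B = v := by
    rw [Matrix.vecMul_vecMul, Matrix.nonsing_inv_mul B hdet, Matrix.vecMul_one]
  have hv0 : ∀ p, 0 ≤ v p := fun p => by simp only [v]; split_ifs <;> norm_num
  have hθ0 : ∀ p, 0 ≤ θ p := fun p => by
    change 0 ≤ ∑ q, v q * B⁻¹ q p
    exact Finset.sum_nonneg fun q _ => mul_nonneg (hv0 q) (hinv q p)
  let η : Fin m → ℝ := fun p => if b p = Fin.last N then 0 else θ p
  have hη0 : ∀ p, 0 ≤ η p := fun p => by
    simp only [η]; split_ifs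
    · exact le_rfl
    · exact hθ0 p
  have hηL : ∀ q, b q ≠ Fin.last N → (η ᵥ* G.lap) q = -1 := by
    intro q hq
    have h1 : ∑ p, θ p * B p q = 1 := by
      have := congrFun hθ q
      simp only [v, hq, if_false] at this
      exact this
    change ∑ p, η p * G.lap p q = -1
    rw [← h1, ← Finset.sum_neg_distrib]
    refine Finset.sum_congr rfl fun p _ => ?_
    by_cases hp : b p = Fin.last N
    · have hpq : p ≠ q := fun e => hq (e ▸ hp)
      simp [η, B, hp, Matrix.one_apply, hpq]
    · simp [η, B, hp]
  refine ⟨η, hη0, fun q hq => (hη0 q).lt_of_ne' fun h0 => ?_, hηL, fun q hq => ?_⟩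
  · have h1 := hηL q hq
    have h2 : 0 ≤ (η ᵥ* G.lap) q := by
      change 0 ≤ ∑ p, η p * G.lap p q
      refine Finset.sum_nonneg fun p _ => ?_
      by_cases hpq : p = q
      · rw [hpq, h0, zero_mul]
      · rw [G.lap_of_ne hpq]; exact mul_nonneg (hη0 p) (G.nonneg p q)
    linarith
  · change 0 ≤ ∑ p, η p * G.lap p q
    refine Finset.sum_nonneg fun p _ => ?_
    by_cases hpq : p = q
    · simp [η, hpq, hq]
    · rw [G.lap_of_ne hpq]; exact mul_nonneg (hη0 p) (G.nonneg p q)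

end WeightedDigraph

end

/-! ### Dissipation inequalities for the combined weight -/

noncomputable section

namespace WeightedDigraph

variable {m N : ℕ} {G : WeightedDigraph m} {b : Fin m → Fin (N + 1)}
  {ξ : {p : Fin m // b p = Fin.last N} → ℝ}

-- Clears the denominator of the test. For an agent without in-neighbours the quotient is zero by
-- convention, and multiplication by the in-degree makes both error terms vanish.
variable (G) in
theorem inDegree_mul_le {γ d e f : ℝ} {i : Fin m} (hγ : 0 ≤ γ) (hd : 0 ≤ d)
    (h : e ^ 2 ≤ γ / (4 * G.inDegree i) * d + f) :
    G.inDegree i * e ^ 2 ≤ γ / 4 * d + G.inDegree i * f := by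
  rcases (G.inDegree_nonneg i).eq_or_lt with h0 | h0
  · rw [← h0, zero_mul, zero_mul, add_zero]; positivity
  · calc G.inDegree i * e ^ 2 ≤ G.inDegree i * (γ / (4 * G.inDegree i) * d + f) :=
        mul_le_mul_of_nonneg_left h h0.le
      _ = _ := by field_simp

variable (G) in
theorem sum_inDegree_mul_le {δ f : ℝ} {γ e u z : Fin m → ℝ} (hu : ∀ i, 0 ≤ u i)
    (hγ : ∀ i, 0 ≤ γ i) (hδ : ∀ i, γ i ≤ 1 - δ)
    (h : ∀ i, e i ^ 2 ≤ γ i / (4 * G.inDegree i) * G.disagreement z i + f) :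
    ∑ i, u i * (G.inDegree i * e i ^ 2) ≤
      (1 - δ) / 4 * G.energy u z + (∑ i, u i * G.inDegree i) * f := by
  rw [energy, Finset.mul_sum, Finset.sum_mul, ← Finset.sum_add_distrib]
  refine Finset.sum_le_sum fun i _ => ?_
  have h1 := G.inDegree_mul_le (hγ i) (G.disagreement_nonneg z i) (h i)
  have h2 := mul_le_mul_of_nonneg_right (hδ i) (G.disagreement_nonneg z i)
  have h3 := mul_le_mul_of_nonneg_left
    (h1.trans (show _ ≤ (1 - δ) / 4 * G.disagreement z i + G.inDegree i * f by linarith)) (hu i)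
  linarith

theorem IsRootWeight.exists_error_bound (hξ : G.IsRootWeight b ξ) (γ : Fin m → ℝ)
    (hγ : ∀ i, 0 ≤ γ i) : ∃ C, 0 ≤ C ∧ ∀ (z e : Fin m → ℝ) (f : ℝ) (q : Fin m),
      b q = Fin.last N → e q ^ 2 ≤ γ q / (4 * G.inDegree q) * G.disagreement z q + f →
      e q ^ 2 ≤ C * G.energy (extendRoot b ξ) z + f := by
  obtain ⟨C, hC, h⟩ := exists_nonneg_forall_le
    fun q => γ q / (4 * G.inDegree q) / extendRoot b ξ q
  refine ⟨C, hC, fun z e f q hq he => he.trans (add_le_add_left ?_ f)⟩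
  have hp := hξ.extend_pos hq
  have hE := G.mul_disagreement_le_energy hξ.extend_nonneg z q
  have hx : 0 ≤ γ q / (4 * G.inDegree q) :=
    div_nonneg (hγ q) (mul_nonneg (by norm_num) (G.inDegree_nonneg q))
  calc γ q / (4 * G.inDegree q) * G.disagreement z q
      = γ q / (4 * G.inDegree q) / extendRoot b ξ q *
        (extendRoot b ξ q * G.disagreement z q) := by field_simp
    _ ≤ C * G.energy (extendRoot b ξ) z := mul_le_mul (h q) hE
        (mul_nonneg hp.le (G.disagreement_nonneg z q)) hC

/-- Supplies the mean needed in the Poincaré inequality for broadcast states: `y` has mean zero, so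
only the mean of the errors remains. -/
theorem IsRootWeight.sq_sum_mul_le (hξ : G.IsRootWeight b ξ) {y e : Fin m → ℝ} {s : ℝ} (hs : 0 ≤ s)
    (hy : ∑ p, extendRoot b ξ p * y p = 0) (he : ∀ q, b q = Fin.last N → e q ^ 2 ≤ s) :
    (∑ p, extendRoot b ξ p * (y + e) p) ^ 2 ≤ s := by
  have a1 : ∑ p, extendRoot b ξ p * (y + e) p = ∑ p, extendRoot b ξ p * e p := by
    simp only [Pi.add_apply, mul_add, Finset.sum_add_distrib, hy, zero_add]
  have a2 : |∑ p, extendRoot b ξ p * e p| ≤ √s := by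
    calc _ ≤ ∑ p, |extendRoot b ξ p * e p| := Finset.abs_sum_le_sum_abs _ _
      _ ≤ ∑ p, extendRoot b ξ p * √s := by
        refine Finset.sum_le_sum fun p _ => ?_
        rw [abs_mul, abs_of_nonneg (hξ.extend_nonneg p)]
        by_cases hp : b p = Fin.last N
        · exact mul_le_mul_of_nonneg_left (Real.abs_le_sqrt (he p hp)) (hξ.extend_nonneg p)
        · simp [extendRoot, hp]
      _ = _ := by rw [← Finset.sum_mul, hξ.sum_extend, one_mul]
  rw [a1, ← sq_abs]
  calc _ ≤ √s ^ 2 := pow_le_pow_left₀ (abs_nonneg _) a2 2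
    _ = _ := Real.sq_sqrt hs

-- Passes from decay in the broadcast states back to the states: the test bounds each error by the
-- total size of the broadcast states.
variable (G) in
theorem sum_sq_le_of_broadcast_error {γ y e : Fin m → ℝ} (hγ : ∀ i, 0 ≤ γ i ∧ γ i < 1)
    (he : ∀ i, e i ^ 2 ≤ γ i / (4 * G.inDegree i) * G.disagreement (y + e) i) :
    ∑ q, y q ^ 2 ≤ m * (4 * ∑ q, (y + e) q ^ 2) := by
  have hsingle : ∀ q, (y + e) q ^ 2 ≤ ∑ q, (y + e) q ^ 2 := fun q =>
    Finset.single_le_sum (f := fun q => (y + e) q ^ 2) (fun q _ => sq_nonneg _) (Finset.mem_univ q)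
  have hS0 : 0 ≤ ∑ q, (y + e) q ^ 2 := Finset.sum_nonneg fun q _ => sq_nonneg _
  generalize ∑ q, (y + e) q ^ 2 = Y at *
  have h : ∀ q, y q ^ 2 ≤ 4 * Y := by
    intro q
    have a1 : G.disagreement (y + e) q ≤ 4 * G.inDegree q * Y := by
      rw [mul_comm (4 : ℝ), mul_assoc, inDegree, Finset.sum_mul]
      refine Finset.sum_le_sum fun j _ => mul_le_mul_of_nonneg_left ?_ (G.nonneg q j)
      nlinarith [hsingle j, hsingle q, sq_nonneg ((y + e) j + (y + e) q)]
    have a2 : e q ^ 2 ≤ Y := by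
      refine (he q).trans ?_
      rcases (G.inDegree_nonneg q).eq_or_lt with h0 | h0
      · simpa [← h0] using hS0
      · rw [div_mul_eq_mul_div, div_le_iff₀ (by positivity)]
        calc γ q * G.disagreement (y + e) q ≤ 1 * G.disagreement (y + e) q :=
            mul_le_mul_of_nonneg_right (hγ q).2.le (G.disagreement_nonneg _ q)
          _ ≤ Y * (4 * G.inDegree q) := by linarith
    have a3 : y q = (y + e) q - e q := by simp
    rw [a3]
    nlinarith [hsingle q, sq_nonneg ((y + e) q + e q)]
  refine (Finset.sum_le_sum fun q _ => h q).trans ?_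
  simp

/-- Exponential dissipation of a weighted square sum when the errors are controlled by the
states. -/
theorem IsFrobeniusForm.exists_dissipation_state (hb : G.IsFrobeniusForm b)
    (hG : G.HasSpanningTree) (hξ : G.IsRootWeight b ξ) (γ : Fin m → ℝ)
    (hγ : ∀ i, 0 ≤ γ i ∧ γ i < 1) :
    ∃ (w : Fin m → ℝ) (c C : ℝ), (∀ i, 0 < w i) ∧ 0 < c ∧ 0 ≤ C ∧
      ∀ (y e : Fin m → ℝ) (f : ℝ), 0 ≤ f → ∑ p, extendRoot b ξ p * y p = 0 →
        (∀ i, e i ^ 2 ≤ γ i / (4 * G.inDegree i) * G.disagreement y i + f) →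
        ∑ p, w p * (y p * (G.lap *ᵥ (y + e)) p) ≤ -c * ∑ p, y p ^ 2 + C * f := by
  obtain ⟨η, hη0, hηpos, hηs, hηr⟩ := hb.exists_dissipative_weight hG
  obtain ⟨δ, hδ, hγδ⟩ := exists_pos_forall_le (fun i => 1 - γ i) (fun i => by linarith [(hγ i).2])
  obtain ⟨C₁, hC₁, h₁⟩ := hξ.poincare hb
  obtain ⟨C₂, hC₂, h₂⟩ := hξ.exists_error_bound γ fun i => (hγ i).1
  -- The summand `1` lets a root agent's share also pay for the decay term `y q ^ 2`, which `η` does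
  -- not produce there.
  have hD : 0 ≤ ∑ q, (|(η ᵥ* G.lap) q| + 1) :=
    Finset.sum_nonneg fun q _ => by positivity
  set D := ∑ q, (|(η ᵥ* G.lap) q| + 1) with hDdef
  set ζ := extendRoot b ξ with hζ
  have hζ0 := hξ.extend_nonneg
  have hA : ∀ u : Fin m → ℝ, (∀ i, 0 ≤ u i) → 0 ≤ ∑ i, u i * G.inDegree i := fun u hu =>
    Finset.sum_nonneg fun i _ => mul_nonneg (hu i) (G.inDegree_nonneg i)
  -- Chosen so that `K * (δ / 4)`, the root dissipation left after absorbing the errors, exceeds the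
  -- cost `D * (C₁ + 2 * C₂)` of `η` on the root component.
  set K := 4 * (D * (C₁ + 2 * C₂)) / δ + 1 with hK
  have hK0 : 0 < K := by positivity
  refine ⟨fun p => K * ζ p + η p, 1 / 4,
    K * (∑ i, ζ i * G.inDegree i) + 2 * D + ∑ i, η i * G.inDegree i, fun p => ?_, by norm_num,
    ?_, fun y e f hf hy he => ?_⟩
  · by_cases hp : b p = Fin.last N
    · exact add_pos_of_pos_of_nonneg (mul_pos hK0 (hξ.extend_pos hp)) (hη0 p)
    · exact add_pos_of_nonneg_of_pos (mul_nonneg hK0.le (hζ0 p)) (hηpos p hp)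
  · have := hA ζ hζ0
    have := hA η hη0
    positivity
  have hEζ := G.energy_nonneg hζ0 y
  have hEη := G.energy_nonneg hη0 y
  have hle : ∀ i, γ i ≤ 1 - δ := fun i => by linarith [hγδ i]
  have e1 := G.sum_mul_lap_le_state ζ y e hζ0
  have e2 := G.sum_mul_lap_le_state η y e hη0
  have e3 := G.sum_inDegree_mul_le hζ0 (fun i => (hγ i).1) hle he
  have e4 := G.sum_inDegree_mul_le hη0 (fun i => (hγ i).1) hle he
  rw [hξ.extend_vecMul hb] at e1
  simp only [Pi.zero_apply, zero_mul, Finset.sum_const_zero, add_zero] at e1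
  have e5 : ∑ q, (η ᵥ* G.lap) q * (1 / 2 * y q ^ 2 + y q * e q + e q ^ 2) ≤
      -(1 / 4) * ∑ q, y q ^ 2 + D * ((C₁ + 2 * C₂) * G.energy ζ y + 2 * f) := by
    rw [hDdef, Finset.mul_sum, Finset.sum_mul, ← Finset.sum_add_distrib]
    refine Finset.sum_le_sum fun q _ => ?_
    by_cases hq : b q = Fin.last N
    · have a1 := h₁ y q hq
      rw [hy] at a1
      have a2 := h₂ y e f q hq (he q)
      have a3 := hηr q hq
      rw [abs_of_nonneg a3]
      have a4 : (1 / 2 * y q ^ 2 + y q * e q + e q ^ 2) ≤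
          (C₁ + 2 * C₂) * G.energy ζ y + 2 * f := by
        nlinarith [sq_nonneg (y q - e q), sq_nonneg (e q)]
      have a5 := mul_le_mul_of_nonneg_left a4 a3
      have a6 : y q ^ 2 ≤ (C₁ + 2 * C₂) * G.energy ζ y + 2 * f := by
        nlinarith [mul_nonneg hC₂ hEζ]
      nlinarith [sq_nonneg (y q)]
    -- Here `1/2 y² + y e + e² = 1/4 y² + 1/4 (y + 2 e)²`, which is where the rate `1/4` comes from.
    · rw [hηs q hq]
      have a1 : 0 ≤ (|(-1 : ℝ)| + 1) * ((C₁ + 2 * C₂) * G.energy ζ y + 2 * f) := by positivity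
      nlinarith [sq_nonneg (y q + 2 * e q)]
  have e6 : K * (δ / 4) * G.energy ζ y =
      D * (C₁ + 2 * C₂) * G.energy ζ y + δ / 4 * G.energy ζ y := by
    rw [hK]; field_simp
  have e7 : ∑ p, (K * ζ p + η p) * (y p * (G.lap *ᵥ (y + e)) p) =
      K * ∑ p, ζ p * (y p * (G.lap *ᵥ (y + e)) p) +
        ∑ p, η p * (y p * (G.lap *ᵥ (y + e)) p) := by
    rw [Finset.mul_sum, ← Finset.sum_add_distrib]
    exact Finset.sum_congr rfl fun p _ => by ring
  rw [e7]
  have e8 := mul_le_mul_of_nonneg_left (e1.trans (add_le_add_right e3 _)) hK0.le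
  have e9 := mul_nonneg hδ.le hEζ
  have e10 := mul_nonneg hδ.le hEη
  linarith

/-- Exponential dissipation of a weighted square sum when the errors are controlled by the
broadcast states. -/
theorem IsFrobeniusForm.exists_dissipation_broadcast (hb : G.IsFrobeniusForm b)
    (hG : G.HasSpanningTree) (hξ : G.IsRootWeight b ξ) (γ : Fin m → ℝ)
    (hγ : ∀ i, 0 ≤ γ i ∧ γ i < 1) :
    ∃ (w : Fin m → ℝ) (c : ℝ), (∀ i, 0 < w i) ∧ 0 < c ∧
      ∀ y e : Fin m → ℝ, ∑ p, extendRoot b ξ p * y p = 0 →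
        (∀ i, e i ^ 2 ≤ γ i / (4 * G.inDegree i) * G.disagreement (y + e) i) →
        ∑ p, w p * (y p * (G.lap *ᵥ (y + e)) p) ≤ -c * ∑ p, y p ^ 2 := by
  obtain ⟨η, hη0, hηpos, hηs, hηr⟩ := hb.exists_dissipative_weight hG
  obtain ⟨δ, hδ, hγδ⟩ := exists_pos_forall_le (fun i => 1 - γ i) (fun i => by linarith [(hγ i).2])
  obtain ⟨C₁, hC₁, h₁⟩ := hξ.poincare hb
  obtain ⟨C₂, hC₂, h₂⟩ := hξ.exists_error_bound γ fun i => (hγ i).1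
  have hD : 0 ≤ ∑ q, (|(η ᵥ* G.lap) q| + 1) :=
    Finset.sum_nonneg fun q _ => by positivity
  set D := ∑ q, (|(η ᵥ* G.lap) q| + 1) with hDdef
  set ζ := extendRoot b ξ with hζ
  have hζ0 := hξ.extend_nonneg
  set C₃ := C₁ * (1 + C₂) with hC₃def
  have hC₃ : 0 ≤ C₃ := by positivity
  set K := 4 * (D * C₃) / δ + 1 with hK
  have hK0 : 0 < K := by positivity
  -- The rate combines the decay `1/2` in the broadcast states with the loss `4 m` of
  -- `sum_sq_le_of_broadcast_error`; `m + 1` keeps the denominator positive.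
  refine ⟨fun p => K * ζ p + η p, 1 / (8 * (m + 1)), fun p => ?_, by positivity,
    fun y e hy he => ?_⟩
  · by_cases hp : b p = Fin.last N
    · exact add_pos_of_pos_of_nonneg (mul_pos hK0 (hξ.extend_pos hp)) (hη0 p)
    · exact add_pos_of_nonneg_of_pos (mul_nonneg hK0.le (hζ0 p)) (hηpos p hp)
  have hEζ := G.energy_nonneg hζ0 (y + e)
  have hEη := G.energy_nonneg hη0 (y + e)
  have hle : ∀ i, γ i ≤ 1 - δ := fun i => by linarith [hγδ i]
  have he' : ∀ i, e i ^ 2 ≤ γ i / (4 * G.inDegree i) * G.disagreement (y + e) i + 0 :=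
    fun i => by rw [add_zero]; exact he i
  have e1 := G.sum_mul_lap_le_broadcast ζ y e hζ0
  have e2 := G.sum_mul_lap_le_broadcast η y e hη0
  have e3 := G.sum_inDegree_mul_le hζ0 (fun i => (hγ i).1) hle he'
  have e4 := G.sum_inDegree_mul_le hη0 (fun i => (hγ i).1) hle he'
  rw [hξ.extend_vecMul hb] at e1
  simp only [Pi.zero_apply, zero_mul, Finset.sum_const_zero, add_zero] at e1
  have emean := hξ.sq_sum_mul_le (mul_nonneg hC₂ hEζ) hy fun q hq => by simpa using h₂ (y + e) e 0 q hq (he' q)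
  have e5 : ∑ q, (η ᵥ* G.lap) q * (1 / 2 * (y + e) q ^ 2) ≤
      -(1 / 2) * ∑ q, (y + e) q ^ 2 + D * (C₃ * G.energy ζ (y + e)) := by
    rw [hDdef, Finset.mul_sum, Finset.sum_mul, ← Finset.sum_add_distrib]
    refine Finset.sum_le_sum fun q _ => ?_
    by_cases hq : b q = Fin.last N
    · have a1 : (y + e) q ^ 2 ≤ C₃ * G.energy ζ (y + e) := by
        refine (h₁ (y + e) q hq).trans ?_
        rw [hC₃def, mul_assoc]
        exact mul_le_mul_of_nonneg_left (by linarith) hC₁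
      have a3 := hηr q hq
      rw [abs_of_nonneg a3]
      nlinarith [mul_le_mul_of_nonneg_left a1 a3, sq_nonneg ((y + e) q),
        mul_nonneg a3 (sq_nonneg ((y + e) q))]
    · rw [hηs q hq]
      have a1 : 0 ≤ (|(-1 : ℝ)| + 1) * (C₃ * G.energy ζ (y + e)) := by positivity
      refine le_trans ?_ (le_add_of_nonneg_right a1)
      linarith
  have e6 : K * (δ / 4) * G.energy ζ (y + e) =
      D * C₃ * G.energy ζ (y + e) + δ / 4 * G.energy ζ (y + e) := by
    rw [hK]; field_simp
  have e7 : ∑ p, (K * ζ p + η p) * (y p * (G.lap *ᵥ (y + e)) p) =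
      K * ∑ p, ζ p * (y p * (G.lap *ᵥ (y + e)) p) +
        ∑ p, η p * (y p * (G.lap *ᵥ (y + e)) p) := by
    rw [Finset.mul_sum, ← Finset.sum_add_distrib]
    exact Finset.sum_congr rfl fun p _ => by ring
  have e8 := mul_le_mul_of_nonneg_left (e1.trans (add_le_add_right e3 _)) hK0.le
  have e9 := mul_nonneg hδ.le hEζ
  have e10 := mul_nonneg hδ.le hEη
  have e11 : ∑ p, (K * ζ p + η p) * (y p * (G.lap *ᵥ (y + e)) p) ≤
      -(1 / 2) * ∑ q, (y + e) q ^ 2 := by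
    rw [e7]; linarith
  refine e11.trans ?_
  have e13 := G.sum_sq_le_of_broadcast_error hγ he
  have hS0 : 0 ≤ ∑ q, (y + e) q ^ 2 := Finset.sum_nonneg fun q _ => sq_nonneg _
  have e14 : 1 / (8 * ((m : ℝ) + 1)) * ∑ q, y q ^ 2 ≤ 1 / 2 * ∑ q, (y + e) q ^ 2 := by
    rw [div_mul_eq_mul_div, div_le_iff₀ (by positivity)]
    nlinarith
  linarith

end WeightedDigraph

end

/-! ### Scalar comparison and general properties of motions and triggers -/

noncomputable section

/-- Comparison of the solution of a scalar differential inequality, for right derivatives, with an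
exponential. -/
theorem le_exp_of_deriv_right_le {V V' : ℝ → ℝ} {a lam κ β B F : ℝ}
    (hV : ContinuousOn V (Set.Icc 0 a))
    (hV' : ∀ s ∈ Set.Ico 0 a, HasDerivWithinAt V (V' s) (Set.Ici s) s)
    (hle : ∀ s ∈ Set.Ico 0 a, V' s ≤ -lam * V s + F * Real.exp (-β * s))
    (hF : 0 ≤ F) (hκβ : κ ≤ β) (h0 : V 0 ≤ B) (hB : F < (lam - κ) * B) :
    ∀ s ∈ Set.Icc 0 a, V s ≤ B * Real.exp (-κ * s) := by
  have hd : ∀ s : ℝ, HasDerivAt (fun s => B * Real.exp (-κ * s)) (-κ * (B * Real.exp (-κ * s))) s :=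
    fun s => by
      have := (((hasDerivAt_id s).const_mul (-κ)).exp).const_mul B
      simp only [id, mul_one] at this
      exact this.congr_deriv (by ring)
  refine fun s hs => image_le_of_deriv_right_lt_deriv_boundary' hV hV' (by simpa using h0)
    (fun s _ => (hd s).continuousAt.continuousWithinAt) (fun s _ => (hd s).hasDerivWithinAt)
    (fun s hs h => ?_) hs
  -- Where `V` touches the barrier, its slope must be strictly smaller; `hB` provides the
  -- strictness.
  have h1 := hle s hs
  have h2 : Real.exp (-β * s) ≤ Real.exp (-κ * s) := Real.exp_le_exp.2 (by nlinarith [hs.1])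
  have h3 := mul_le_mul_of_nonneg_left h2 hF
  have h4 := mul_lt_mul_of_pos_right hB (Real.exp_pos (-κ * s))
  rw [h] at h1
  linarith

namespace Run

variable {m : ℕ} {S : Run m} {L : Matrix (Fin m) (Fin m) ℝ}

namespace IsMotion

theorem nonneg (hS : S.IsMotion L) (i : Fin m) (k : ℕ) : 0 ≤ S.t i k := by
  rw [← hS.start i]; exact hS.mono i (Nat.zero_le k)

theorem exists_coe (hS : S.IsMotion L) {i : Fin m} {k : ℕ} {u : EReal} (h : S.t i k < u) :
    ∃ r : ℝ, S.t i k = (r : EReal) ∧ 0 ≤ r := by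
  have h0 := hS.nonneg i k
  have h1 : ((S.t i k).toReal : EReal) = S.t i k :=
    EReal.coe_toReal h.ne_top (ne_of_gt (lt_of_lt_of_le EReal.bot_lt_zero h0))
  refine ⟨(S.t i k).toReal, h1.symm, ?_⟩
  rw [← h1] at h0
  exact_mod_cast h0

theorem exists_index (hS : S.IsMotion L) (i : Fin m) {s : ℝ} (h0 : 0 ≤ s) (hs : (s : EReal) < S.T) :
    ∃ k, S.t i k ≤ (s : EReal) ∧ (s : EReal) < S.t i (k + 1) := by
  classical
  have hex := hS.locFinite i s hs
  have hn := Nat.find_spec hex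
  have hmin : ∀ {k}, k < Nat.find hex → ¬ (s : EReal) < S.t i k := fun h => Nat.find_min hex h
  generalize Nat.find hex = n at hn hmin
  cases n with
  | zero => rw [hS.start] at hn; exact absurd h0 (not_le.2 (by exact_mod_cast hn))
  | succ n => exact ⟨n, not_lt.1 (hmin n.lt_succ_self), hn⟩

theorem counter_eq (hS : S.IsMotion L) {i : Fin m} {k : ℕ} {s : ℝ} (h1 : S.t i k ≤ (s : EReal))
    (h2 : (s : EReal) < S.t i (k + 1)) : S.counter i s = k := by
  have : {k | S.t i k ≤ (s : EReal)} = Set.Iic k := by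
    ext j
    refine ⟨fun hj => ?_, fun hj => (hS.mono i hj).trans h1⟩
    by_contra hjk
    exact absurd ((hS.mono i (Nat.succ_le_of_lt (not_le.1 hjk))).trans hj) (not_le.2 h2)
  rw [counter, this, csSup_Iic]

theorem counterPre_eq (hS : S.IsMotion L) {i : Fin m} {k : ℕ} {s : ℝ} (h1 : S.t i k < (s : EReal))
    (h2 : (s : EReal) ≤ S.t i (k + 1)) : S.counterPre i s = k := by
  have : {k | S.t i k < (s : EReal)} = Set.Iic k := by
    ext j
    refine ⟨fun hj => ?_, fun hj => (hS.mono i hj).trans_lt h1⟩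
    by_contra hjk
    exact absurd ((hS.mono i (Nat.succ_le_of_lt (not_le.1 hjk))).trans_lt hj) (not_lt.2 h2)
  rw [counterPre, this, csSup_Iic]

theorem xhat_eq (hS : S.IsMotion L) {i : Fin m} {k : ℕ} {s : ℝ} (h1 : S.t i k ≤ (s : EReal))
    (h2 : (s : EReal) < S.t i (k + 1)) : S.xhat s i = S.x (S.t i k).toReal i := by
  rw [xhat, hS.counter_eq h1 h2]

theorem xhat_eq_of_not_triggersAt (hS : S.IsMotion L) {i : Fin m} {a r : ℝ} (h0 : 0 ≤ a)
    (har : a ≤ r) (hr : (r : EReal) < S.T) (h : ∀ u, a < u → u ≤ r → ¬ S.TriggersAt i u) :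
    S.xhat r i = S.xhat a i := by
  have har' : (a : EReal) ≤ r := by exact_mod_cast har
  obtain ⟨k, h1, h2⟩ := hS.exists_index i h0 (har'.trans_lt hr)
  have h3 : (r : EReal) < S.t i (k + 1) := by
    by_contra h3
    rw [not_lt] at h3
    obtain ⟨u, hu, _⟩ := hS.exists_coe (h3.trans_lt hr)
    rw [hu] at h2 h3
    exact h u (by exact_mod_cast h2) (by exact_mod_cast h3) ⟨k + 1, hu⟩
  rw [hS.xhat_eq h1 h2, hS.xhat_eq (h1.trans har') h3]

theorem xhatPre_eq_of_not_triggersAt (hS : S.IsMotion L) {i : Fin m} {a s : ℝ} (h0 : 0 ≤ a)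
    (has : a < s) (hs : (s : EReal) < S.T) (h : ∀ u, a < u → u < s → ¬ S.TriggersAt i u) :
    S.xhatPre s i = S.xhat a i := by
  have has' : (a : EReal) < s := by exact_mod_cast has
  obtain ⟨k, h1, h2⟩ := hS.exists_index i h0 (has'.trans hs)
  have h3 : (s : EReal) ≤ S.t i (k + 1) := by
    by_contra h3
    rw [not_le] at h3
    obtain ⟨u, hu, _⟩ := hS.exists_coe h3
    rw [hu] at h2 h3
    exact h u (by exact_mod_cast h2) (by exact_mod_cast h3) ⟨k + 1, hu⟩
  rw [hS.xhat_eq h1 h2, xhatPre, hS.counterPre_eq (h1.trans_lt has') h3]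

/-- The broadcast states are right locally constant. -/
theorem exists_xhat_const (hS : S.IsMotion L) {s : ℝ} (h0 : 0 ≤ s) (hs : (s : EReal) < S.T) :
    ∃ u : ℝ, s < u ∧ (u : EReal) < S.T ∧ ∀ r, s ≤ r → r ≤ u → S.xhat r = S.xhat s := by
  have key : ∀ i, ∃ u : ℝ, s < u ∧ (u : EReal) < S.T ∧
      ∀ r, s ≤ r → r ≤ u → S.xhat r i = S.xhat s i := by
    intro i
    obtain ⟨k, h1, h2⟩ := hS.exists_index i h0 hs
    obtain ⟨u, hu1, hu2⟩ := EReal.lt_iff_exists_real_btwn.1 (lt_min h2 hs)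
    refine ⟨u, by exact_mod_cast hu1, hu2.trans_le (min_le_right _ _), fun r hr1 hr2 => ?_⟩
    have hr1' : (s : EReal) ≤ r := by exact_mod_cast hr1
    have hr2' : (r : EReal) ≤ u := by exact_mod_cast hr2
    rw [hS.xhat_eq h1 h2,
      hS.xhat_eq (h1.trans hr1') (hr2'.trans_lt (hu2.trans_le (min_le_left _ _)))]
  choose u hu1 hu2 hu3 using key
  obtain ⟨δ, hδ, hle⟩ := exists_pos_forall_le (fun i => u i - s) (fun i => sub_pos.2 (hu1 i))
  obtain ⟨v, hv1, hv2⟩ := EReal.lt_iff_exists_real_btwn.1 hs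
  have hv1' : s < v := by exact_mod_cast hv1
  refine ⟨min v (s + δ), lt_min hv1' (by linarith), lt_of_le_of_lt ?_ hv2, fun r hr1 hr2 => ?_⟩
  · exact_mod_cast min_le_left _ _
  · funext i
    exact hu3 i r hr1 (by linarith [hle i, min_le_right v (s + δ)])

theorem Icc_subset {a c : ℝ} (ha : 0 ≤ a) (hc : (c : EReal) < S.T) :
    Set.Icc a c ⊆ {s : ℝ | 0 ≤ s ∧ (s : EReal) < S.T} := fun s hs =>
  ⟨ha.trans hs.1, lt_of_le_of_lt (by exact_mod_cast hs.2) hc⟩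

theorem continuousOn_apply (hS : S.IsMotion L) {a c : ℝ} (ha : 0 ≤ a) (hc : (c : EReal) < S.T)
    (i : Fin m) : ContinuousOn (fun s => S.x s i) (Set.Icc a c) :=
  (continuous_apply i).comp_continuousOn (hS.cont.mono (Icc_subset ha hc))

theorem ode_Ico (hS : S.IsMotion L) {a c : ℝ} (ha : 0 ≤ a) (hc : (c : EReal) < S.T) (i : Fin m)
    {s : ℝ} (hs : s ∈ Set.Ico a c) :
    HasDerivWithinAt (fun r => S.x r i) ((L *ᵥ S.xhat s) i) (Set.Ici s) s :=
  let h := Icc_subset ha hc (Set.Ico_subset_Icc_self hs)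
  hS.ode s h.1 h.2 i

theorem x_eq_of_rate_const (hS : S.IsMotion L) {a c u : ℝ} (ha : 0 ≤ a) (hc : (c : EReal) < S.T)
    (i : Fin m) (h : ∀ r ∈ Set.Ico a c, (L *ᵥ S.xhat r) i = u) {r : ℝ} (hr : r ∈ Set.Icc a c) :
    S.x r i = S.x a i + (r - a) * u := by
  have h1 : ContinuousOn (fun s => S.x s i - (s - a) * u) (Set.Icc a c) :=
    (hS.continuousOn_apply ha hc i).sub (by fun_prop)
  have h2 : ∀ s ∈ Set.Ico a c,
      HasDerivWithinAt (fun s => S.x s i - (s - a) * u) 0 (Set.Ici s) s := by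
    intro s hs
    have h3 := hS.ode_Ico ha hc i hs
    rw [h s hs] at h3
    have h4 : HasDerivWithinAt (fun s : ℝ => (s - a) * u) u (Set.Ici s) s := by
      simpa using (((hasDerivAt_id s).sub_const a).mul_const u).hasDerivWithinAt
    simpa using h3.fun_sub h4
  have h5 := constant_of_has_deriv_right_zero h1 h2 r hr
  simp only [sub_self, zero_mul, sub_zero] at h5
  linarith

/-- A weighted sum of the states is conserved if the weight is a left null vector. -/
theorem sum_mul_const (hS : S.IsMotion L) {ζ : Fin m → ℝ} (hζ : ζ ᵥ* L = 0) {s : ℝ} (h0 : 0 ≤ s)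
    (hs : (s : EReal) < S.T) : ∑ p, ζ p * S.x s p = ∑ p, ζ p * S.x 0 p := by
  refine constant_of_has_deriv_right_zero (f := fun s => ∑ p, ζ p * S.x s p) (a := 0) (b := s)
    (continuousOn_finsetSum _ fun p _ =>
      continuousOn_const.mul (hS.continuousOn_apply le_rfl hs p)) (fun r hr => ?_) s ⟨h0, le_rfl⟩
  have h1 := HasDerivWithinAt.fun_sum (u := Finset.univ) fun p _ =>
    (hS.ode_Ico le_rfl hs p hr).const_mul (ζ p)
  have h2 : ∑ p, ζ p * (L *ᵥ S.xhat r) p = 0 := by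
    change ζ ⬝ᵥ (L *ᵥ S.xhat r) = 0
    rw [Matrix.dotProduct_mulVec, hζ, zero_dotProduct]
  rwa [h2] at h1

end IsMotion

/-- A time below the supremum lies below an admissible `τ`, and before the trigger the predicted
motion is the actual one. -/
theorem NextByTest.holdsBefore {test : AgentTest m} {i : Fin m} {k : ℕ}
    (h : S.NextByTest L test i k) : S.HoldsBefore test i k (min (S.t i (k + 1)) S.T) := by
  rcases h with ⟨_, h2⟩ | ⟨s, hs, _, hlub⟩
  · exact fun r hr1 hr2 => h2 r hr1 (hr2.trans_le (min_le_right _ _))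
  · intro r hr1 hr2
    have hrs : r < s := by
      have := hr2.trans_le (min_le_left _ _)
      rw [hs] at this
      exact_mod_cast this
    obtain ⟨τ, hτ, hrτ⟩ := (lt_isLUB_iff hlub).1 hrs
    have := hτ.2 r hr1 hrτ.le
    have e1 : S.predState L s (S.view i k s) r = S.x r := by
      funext p; simp [predState, hrs.le]
    have e2 : S.predHat s (S.view i k s) r = S.xhat r := by simp [predHat, hrs]
    rwa [e1, e2] at this

/-- The intervals between triggers cover `[0, T)`; this bound on the errors is all that the
convergence proofs use of a rule. -/
theorem IsMotion.test_of_holdsBefore (hS : S.IsMotion L) {test : AgentTest m} {i : Fin m}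
    (hold : ∀ k, S.t i k < S.T → S.HoldsBefore test i k (min (S.t i (k + 1)) S.T)) {s : ℝ}
    (h0 : 0 ≤ s) (hs : (s : EReal) < S.T) : test i s (S.x s) (S.xhat s) := by
  obtain ⟨k, h1, h2⟩ := hS.exists_index i h0 hs
  exact hold k (h1.trans_lt hs) s h1 (lt_min h2 hs)

/-- No agent triggers twice at the same instant. -/
theorem IsMotion.lt_succ_of_nextByTest (hS : S.IsMotion L) {test : AgentTest m} {i : Fin m}
    (hold : ∀ k, S.t i k < S.T → S.HoldsBefore test i k (min (S.t i (k + 1)) S.T)) {k : ℕ}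
    (hk : S.t i k < S.T) (h : S.NextByTest L test i k) : S.t i k < S.t i (k + 1) := by
  by_contra hcon
  have heq : S.t i (k + 1) = S.t i k := le_antisymm (not_lt.1 hcon) (hS.mono i k.le_succ)
  rcases h with ⟨h1, _⟩ | ⟨s, hs, hsT, hlub⟩
  · exact absurd (heq ▸ h1) (not_le.2 hk)
  have hks : S.t i k = s := heq ▸ hs
  have h0 : 0 ≤ s := by
    have := hS.nonneg i k
    rw [hks] at this
    exact_mod_cast this
  -- `n` is the last trigger at the instant `s`. Having already triggered at `s`, the agent sees the
  -- final broadcast values there, so its prediction is the actual motion for a while. The test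
  -- holds on it, against the supremum being `s`.
  obtain ⟨n, hn1, hn2⟩ := hS.exists_index i h0 hsT
  have hkn : k ≤ n := by
    by_contra hkn
    exact absurd (hS.mono i (Nat.succ_le_of_lt (not_le.1 hkn))) (not_le.2 (hks ▸ hn2))
  have hns : S.t i n = s := le_antisymm hn1 (hks ▸ hS.mono i hkn)
  have hview : S.view i k s = S.xhat s := by
    funext j
    by_cases hj : j = i
    · subst hj
      rw [hS.xhat_eq hn1 hn2, hns]
      simp [view, hks]
    · simp [view, hj, hks]
  obtain ⟨u, hu1, hu2, hu3⟩ := hS.exists_xhat_const h0 hsT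
  obtain ⟨v, hv1, hv2⟩ := EReal.lt_iff_exists_real_btwn.1 (lt_min hn2 hsT)
  have hv1' : s < v := by exact_mod_cast hv1
  refine absurd (hlub.1 (show min u v ∈ _ from ⟨?_, fun r hr1 hr2 => ?_⟩))
    (not_le.2 (lt_min hu1 hv1'))
  · rw [hks]; exact_mod_cast (lt_min hu1 hv1').le
  · rw [hks] at hr1
    have hr1' : s ≤ r := by exact_mod_cast hr1
    have hru : r ≤ u := hr2.trans (min_le_left _ _)
    have hrv : (r : EReal) ≤ v := by exact_mod_cast hr2.trans (min_le_right _ _)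
    have htest := hold n (hns ▸ hsT) r (hns ▸ hr1) (hrv.trans_lt hv2)
    have e1 : S.predHat s (S.view i k s) r = S.xhat r := by
      rw [predHat, if_neg (not_lt.2 hr1'), hview, hu3 r hr1' hru]
    have e2 : S.predState L s (S.view i k s) r = S.x r := by
      funext p
      rw [predState, hview]
      split_ifs with hrs
      · rfl
      · exact (hS.x_eq_of_rate_const h0 hu2 p
          (fun q hq => by rw [hu3 q hq.1 hq.2.le]) ⟨hr1', hru⟩).symm
    rwa [e1, e2]

end Run

end

/-! ### Exponential convergence on `[0, T)`, and Rules 1 and 2 -/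

noncomputable section

variable {m N : ℕ} {G : WeightedDigraph m} {b : Fin m → Fin (N + 1)}
  {ξ : {p : Fin m // b p = Fin.last N} → ℝ}

theorem WeightedDigraph.lap_mulVec_sub_const (z : Fin m → ℝ) (v : ℝ) :
    G.lap *ᵥ (fun p => z p - v) = G.lap *ᵥ z := by
  funext i
  simp [G.lap_mulVec]

theorem WeightedDigraph.disagreement_sub_const (z : Fin m → ℝ) (v : ℝ) (i : Fin m) :
    G.disagreement (fun p => z p - v) i = G.disagreement z i := by
  simp [disagreement]

namespace Run

/-- All agents approach the common value `v` with rate `c` as long as the run exists. -/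
def ApproachesWithRate (S : Run m) (c v : ℝ) : Prop :=
  ∃ C : ℝ, 0 ≤ C ∧ ∀ i, ∀ s : ℝ, 0 ≤ s → (s : EReal) < S.T → |S.x s i - v| ≤ C * Real.exp (-c * s)

/-- A quadratic Lyapunov function with an exponentially decaying forcing term yields exponential
decay. -/
theorem IsMotion.exists_rate (L : Matrix (Fin m) (Fin m) ℝ) {w : Fin m → ℝ} {c β : ℝ}
    (hw : ∀ i, 0 < w i) (hc : 0 < c) (hβ : 0 < β) : ∃ κ, 0 < κ ∧ ∀ (S : Run m) (v F : ℝ),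
      S.IsMotion L → 0 ≤ F → (∀ s : ℝ, 0 ≤ s → (s : EReal) < S.T →
        ∑ p, w p * ((S.x s p - v) * (L *ᵥ S.xhat s) p) ≤
          -c * ∑ p, (S.x s p - v) ^ 2 + F * Real.exp (-β * s)) →
      S.ApproachesWithRate κ v := by
  obtain ⟨W, hW0, hW⟩ := exists_nonneg_forall_le w
  obtain ⟨ω, hω, hωw⟩ := exists_pos_forall_le w hw
  set lam := 2 * c / (W + 1) with hlam
  have hlam0 : 0 < lam := by positivity
  -- `V` decays at the slower of half its own rate and the rate of the forcing, and the states at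
  -- half of that. The rate is fixed before the run is introduced.
  set μ := min (lam / 2) β with hμ
  have hμ0 : 0 < μ := lt_min (by positivity) hβ
  refine ⟨μ / 2, by positivity, fun S v F hS hF h => ?_⟩
  set V : ℝ → ℝ := fun s => ∑ p, w p * (S.x s p - v) ^ 2 with hVdef
  have hV0 : ∀ s, 0 ≤ V s := fun s =>
    Finset.sum_nonneg fun p _ => mul_nonneg (hw p).le (sq_nonneg _)
  -- Large enough for `(lam - μ) * B > 2 * F`, the strict condition of the comparison lemma.
  set B := V 0 + (2 * F + 1) * (2 / lam) with hB
  have hB0 : 0 ≤ B := add_nonneg (hV0 0) (by positivity)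
  have hVle : ∀ s : ℝ, 0 ≤ s → (s : EReal) < S.T → V s ≤ B * Real.exp (-μ * s) := by
    intro s h0 hs
    refine le_exp_of_deriv_right_le (V := V)
      (V' := fun s => 2 * ∑ p, w p * ((S.x s p - v) * (L *ᵥ S.xhat s) p)) (lam := lam) (β := β)
      (F := 2 * F) ?_ (fun r hr => ?_) (fun r hr => ?_) (by positivity) (min_le_right _ _)
      (le_add_of_nonneg_right (by positivity)) ?_ s ⟨h0, le_rfl⟩
    · exact continuousOn_finsetSum _ fun p _ => continuousOn_const.mul
        (((hS.continuousOn_apply le_rfl hs p).sub continuousOn_const).pow 2)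
    · have h1 := HasDerivWithinAt.fun_sum (u := Finset.univ) fun p _ =>
        ((((hS.ode_Ico le_rfl hs p hr).sub_const v).fun_pow 2).const_mul (w p))
      refine h1.congr_deriv ?_
      rw [Finset.mul_sum]
      refine Finset.sum_congr rfl fun p _ => ?_
      push_cast
      ring
    · have hr' := IsMotion.Icc_subset le_rfl hs (Set.Ico_subset_Icc_self hr)
      have h1 := h r hr'.1 hr'.2
      have h2 : lam * V r ≤ 2 * c * ∑ p, (S.x r p - v) ^ 2 := by
        rw [hlam, div_mul_eq_mul_div, div_le_iff₀ (by positivity), mul_assoc (2 * c)]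
        refine mul_le_mul_of_nonneg_left ?_ (by positivity)
        rw [hVdef, Finset.sum_mul]
        refine Finset.sum_le_sum fun p _ => ?_
        nlinarith [hW p, sq_nonneg (S.x r p - v)]
      linarith
    · have h1 : lam / 2 ≤ lam - μ := by linarith [min_le_left (lam / 2) β]
      have h2 : 2 * F + 1 ≤ lam / 2 * B := by
        have : lam / 2 * ((2 * F + 1) * (2 / lam)) = 2 * F + 1 := by field_simp
        rw [hB, mul_add, this]
        have := mul_nonneg (half_pos hlam0).le (hV0 0)
        linarith
      have h3 := mul_le_mul_of_nonneg_right h1 hB0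
      linarith
  refine ⟨√(B / ω), Real.sqrt_nonneg _, fun i s h0 hs => ?_⟩
  refine abs_le_of_sq_le_sq ?_ (by positivity)
  rw [mul_pow, Real.sq_sqrt (by positivity), ← Real.exp_nat_mul, div_mul_eq_mul_div,
    le_div_iff₀ hω]
  have h1 : w i * (S.x s i - v) ^ 2 ≤ V s :=
    Finset.single_le_sum (f := fun p => w p * (S.x s p - v) ^ 2)
      (fun p _ => mul_nonneg (hw p).le (sq_nonneg _)) (Finset.mem_univ i)
  have h2 : ((2 : ℕ) : ℝ) * (-(μ / 2) * s) = -μ * s := by push_cast; ring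
  rw [h2]
  have h3 := mul_le_mul_of_nonneg_right (hωw i) (sq_nonneg (S.x s i - v))
  linarith [hVle s h0 hs]

theorem IsMotion.sum_extendRoot_sub {S : Run m} (hS : S.IsMotion G.lap)
    (hb : G.IsFrobeniusForm b) (hξ : G.IsRootWeight b ξ) {s : ℝ} (h0 : 0 ≤ s)
    (hs : (s : EReal) < S.T) :
    ∑ p, WeightedDigraph.extendRoot b ξ p * (S.x s p - S.rootAverage ξ) = 0 := by
  simp only [mul_sub, Finset.sum_sub_distrib, ← Finset.sum_mul, hξ.sum_extend, one_mul,
    hS.sum_mul_const (hξ.extend_vecMul hb) h0 hs]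
  rw [WeightedDigraph.sum_extendRoot_mul, rootAverage, sub_self]

/-- Convergence when the errors are controlled by the disagreement of the states and a decaying
exponential. -/
theorem exists_rate_of_state_bound (hG : G.HasSpanningTree) (hb : G.IsFrobeniusForm b)
    (hξ : G.IsRootWeight b ξ) (γ : Fin m → ℝ) (hγ : ∀ i, 0 ≤ γ i ∧ γ i < 1) {β : ℝ} (hβ : 0 < β) :
    ∃ κ, 0 < κ ∧ ∀ (S : Run m) (Φ : ℝ), S.IsMotion G.lap → 0 ≤ Φ →
      (∀ (s : ℝ) (i : Fin m), 0 ≤ s → (s : EReal) < S.T → (S.xhat s i - S.x s i) ^ 2 ≤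
        γ i / (4 * G.inDegree i) * G.disagreement (S.x s) i + Φ * Real.exp (-β * s)) →
      S.ApproachesWithRate κ (S.rootAverage ξ) := by
  obtain ⟨w, c, C, hw, hc, hC, hdiss⟩ := hb.exists_dissipation_state hG hξ γ hγ
  obtain ⟨κ, hκ, hrate⟩ := IsMotion.exists_rate G.lap hw hc hβ
  refine ⟨κ, hκ, fun S Φ hS hΦ h => hrate S _ (C * Φ) hS (mul_nonneg hC hΦ) fun s h0 hs => ?_⟩
  have h1 := hdiss (fun p => S.x s p - S.rootAverage ξ) (fun p => S.xhat s p - S.x s p)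
    (Φ * Real.exp (-β * s)) (by positivity) (hS.sum_extendRoot_sub hb hξ h0 hs)
    (fun i => by rw [WeightedDigraph.disagreement_sub_const]; exact h s i h0 hs)
  have h2 : (fun p => S.x s p - S.rootAverage ξ) + (fun p => S.xhat s p - S.x s p) =
      fun p => S.xhat s p - S.rootAverage ξ := by
    funext p; simp
  rwa [h2, WeightedDigraph.lap_mulVec_sub_const, ← mul_assoc] at h1

/-- Convergence when the errors are controlled by the disagreement of the broadcast states. -/
theorem exists_rate_of_broadcast_bound (hG : G.HasSpanningTree) (hb : G.IsFrobeniusForm b)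
    (hξ : G.IsRootWeight b ξ) (γ : Fin m → ℝ) (hγ : ∀ i, 0 ≤ γ i ∧ γ i < 1) :
    ∃ κ, 0 < κ ∧ ∀ S : Run m, S.IsMotion G.lap →
      (∀ (s : ℝ) (i : Fin m), 0 ≤ s → (s : EReal) < S.T → (S.xhat s i - S.x s i) ^ 2 ≤
        γ i / (4 * G.inDegree i) * G.disagreement (S.xhat s) i) →
      S.ApproachesWithRate κ (S.rootAverage ξ) := by
  obtain ⟨w, c, hw, hc, hdiss⟩ := hb.exists_dissipation_broadcast hG hξ γ hγ
  obtain ⟨κ, hκ, hrate⟩ := IsMotion.exists_rate G.lap hw hc one_pos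
  refine ⟨κ, hκ, fun S hS h => hrate S _ 0 hS le_rfl fun s h0 hs => ?_⟩
  have h2 : (fun p => S.x s p - S.rootAverage ξ) + (fun p => S.xhat s p - S.x s p) =
      fun p => S.xhat s p - S.rootAverage ξ := by
    funext p; simp
  have h1 := hdiss (fun p => S.x s p - S.rootAverage ξ) (fun p => S.xhat s p - S.x s p)
    (hS.sum_extendRoot_sub hb hξ h0 hs)
    (fun i => by rw [h2, WeightedDigraph.disagreement_sub_const]; exact h s i h0 hs)
  rwa [h2, WeightedDigraph.lap_mulVec_sub_const, ← add_zero (-c * _), ← zero_mul] at h1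

theorem ApproachesWithRate.consensusWithRate {S : Run m} {c v : ℝ} (h : S.ApproachesWithRate c v)
    (hT : S.T = ⊤) : S.ConsensusWithRate c v := by
  obtain ⟨C, _, h⟩ := h
  exact ⟨C, fun i s h0 => h i s h0 (by rw [hT]; exact EReal.coe_lt_top s)⟩

theorem ConsensusWithRate.tendsto {S : Run m} {c v : ℝ} (h : S.ConsensusWithRate c v)
    (hc : 0 < c) (i : Fin m) : Tendsto (fun s => S.x s i) atTop (𝓝 v) := by
  obtain ⟨C, h⟩ := h
  rw [tendsto_iff_dist_tendsto_zero]
  have h1 : Tendsto (fun s => C * Real.exp (-c * s)) atTop (𝓝 0) := by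
    rw [← mul_zero C]
    exact (Real.tendsto_exp_atBot.comp
      (tendsto_id.const_mul_atTop_of_neg (neg_lt_zero.2 hc))).const_mul C
  refine squeeze_zero' (Eventually.of_forall fun s => dist_nonneg) ?_ h1
  filter_upwards [eventually_ge_atTop 0] with s hs
  rw [Real.dist_eq]
  exact h i s hs

theorem IsMotion.zenoFree {S : Run m} {L : Matrix (Fin m) (Fin m) ℝ} (hS : S.IsMotion L)
    (hT : S.T = ⊤) : S.ZenoFree := by
  intro i B
  obtain ⟨k, hk⟩ := hS.locFinite i B (by rw [hT]; exact EReal.coe_lt_top B)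
  refine (Set.finite_lt_nat k).subset fun n hn => ?_
  by_contra hnk
  exact absurd ((hS.mono i (not_lt.1 hnk)).trans hn) (not_le.2 hk)

theorem IsMotion.T_eq_top {S : Run m} {L : Matrix (Fin m) (Fin m) ℝ} (hS : S.IsMotion L)
    (h : ∀ (Tr : ℝ), S.T = (Tr : EReal) → ∀ i, (∀ k, S.t i k < S.T) → False) : S.T = ⊤ := by
  by_contra hT
  obtain ⟨i, hi⟩ := hS.maximal.resolve_left hT
  exact h S.T.toReal (EReal.coe_toReal hT (ne_bot_of_gt hS.T_pos)).symm i hi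

/-- Right after a trigger given by the test, the motion that the agent predicts violates the
test. -/
theorem exists_not_test_of_isLUB {S : Run m} {L : Matrix (Fin m) (Fin m) ℝ} {test : AgentTest m}
    {i : Fin m} {k : ℕ} {s τ : ℝ}
    (hold : S.HoldsBefore test i k s) (hks : S.t i k ≤ (s : EReal))
    (hlub : IsLUB {τ : ℝ | S.t i k ≤ (τ : EReal) ∧ ∀ r : ℝ, S.t i k ≤ (r : EReal) → r ≤ τ →
      test i r (S.predState L s (S.view i k s) r) (S.predHat s (S.view i k s) r)} s)
    (hτ : s < τ) : ∃ r, s ≤ r ∧ r ≤ τ ∧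
      ¬ test i r (S.predState L s (S.view i k s) r) (S.view i k s) := by
  by_contra! hcon
  refine absurd (hlub.1 (show τ ∈ _ from ⟨hks.trans ?_, fun r hr1 hr2 => ?_⟩)) (not_le.2 hτ)
  · exact_mod_cast hτ.le
  · by_cases hrs : r < s
    · have e1 : S.predState L s (S.view i k s) r = S.x r := by
        funext p; simp [predState, hrs.le]
      have e2 : S.predHat s (S.view i k s) r = S.xhat r := by simp [predHat, hrs]
      rw [e1, e2]
      exact hold r hr1 (by exact_mod_cast hrs)
    · rw [predHat, if_neg hrs]
      exact hcon r (not_lt.1 hrs) hr2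

end Run

theorem exists_rate_stateRun (hG : G.HasSpanningTree) (hb : G.IsFrobeniusForm b)
    (hξ : G.IsRootWeight b ξ) (γ : Fin m → ℝ) (hγ : ∀ i, 0 < γ i ∧ γ i < 1) :
    ∃ κ, 0 < κ ∧ ∀ S : Run m, IsStateRun G γ S →
      S.ApproachesWithRate κ (S.rootAverage ξ) := by
  obtain ⟨κ, hκ, h⟩ := Run.exists_rate_of_state_bound hG hb hξ γ
    (fun i => ⟨(hγ i).1.le, (hγ i).2⟩) one_pos
  refine ⟨κ, hκ, fun S hS => h S 0 hS.motion le_rfl fun s i h0 hs => ?_⟩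
  have h1 : stateTest G.lap γ i s (S.x s) (S.xhat s) :=
    hS.motion.test_of_holdsBefore (fun k hk => (hS.rule i k hk).holdsBefore) h0 hs
  rw [stateTest, G.abs_lap_diag, G.lap_sum_sq] at h1
  have h2 : 0 ≤ γ i / (4 * G.inDegree i) * G.disagreement (S.x s) i :=
    mul_nonneg (div_nonneg (hγ i).1.le (mul_nonneg (by norm_num) (G.inDegree_nonneg i)))
      (G.disagreement_nonneg _ i)
  have h3 := pow_le_pow_left₀ (abs_nonneg _) h1 2
  rw [sq_abs, Real.sq_sqrt h2] at h3
  simpa using h3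

/-- Without a further trigger the broadcast value stays frozen while the threshold tends to zero, so
the frozen value would have to be the consensus value. -/
theorem IsStateRun.lt_succ_lt_top {γ : Fin m → ℝ} {S : Run m} (hS : IsStateRun G γ S)
    (hT : S.T = ⊤) {v : ℝ} (hlim : ∀ i, Tendsto (fun s => S.x s i) atTop (𝓝 v)) {i : Fin m}
    {k : ℕ} (hk : S.t i k < ⊤) (hne : S.x (S.t i k).toReal i ≠ v) :
    S.t i k < S.t i (k + 1) ∧ S.t i (k + 1) < ⊤ := by
  have hold := fun n (hn : S.t i n < S.T) => (hS.rule i n hn).holdsBefore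
  have hkT : S.t i k < S.T := hT ▸ hk
  refine ⟨hS.motion.lt_succ_of_nextByTest hold hkT (hS.rule i k hkT), lt_top_iff_ne_top.2 ?_⟩
  intro htop
  obtain ⟨r, hr, hr0⟩ := hS.motion.exists_coe hk
  have hev : ∀ᶠ s in atTop, |S.x (S.t i k).toReal i - S.x s i| ≤
      √(γ i / (4 * |G.lap i i|) * ∑ j, G.lap i j * (S.x s j - S.x s i) ^ 2) := by
    filter_upwards [eventually_ge_atTop r] with s hs
    have h1 : S.t i k ≤ (s : EReal) := by rw [hr]; exact_mod_cast hs
    have h2 : (s : EReal) < S.t i (k + 1) := htop ▸ EReal.coe_lt_top s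
    have h3 := hold k hkT s h1 (lt_min h2 (hT ▸ EReal.coe_lt_top s))
    rw [stateTest, hS.motion.xhat_eq h1 h2] at h3
    exact h3
  have h1 : Tendsto (fun s => √(γ i / (4 * |G.lap i i|) *
      ∑ j, G.lap i j * (S.x s j - S.x s i) ^ 2)) atTop (𝓝 0) := by
    have h2 : Tendsto (fun s => γ i / (4 * |G.lap i i|) *
        ∑ j, G.lap i j * (S.x s j - S.x s i) ^ 2) atTop
        (𝓝 (γ i / (4 * |G.lap i i|) * ∑ j, G.lap i j * (v - v) ^ 2)) :=
      (tendsto_finsetSum _ fun j _ =>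
        (((hlim j).sub (hlim i)).pow 2).const_mul (G.lap i j)).const_mul _
    have h3 := (Real.continuous_sqrt.tendsto _).comp h2
    simpa [Function.comp_def] using h3
  have h2 : Tendsto (fun s => |S.x (S.t i k).toReal i - S.x s i|) atTop
      (𝓝 |S.x (S.t i k).toReal i - v|) := (tendsto_const_nhds.sub (hlim i)).abs
  have h3 := le_of_tendsto_of_tendsto h2 h1 hev
  exact hne (sub_eq_zero.1 (abs_nonpos_iff.1 h3))

theorem exists_rate_decayRun (hG : G.HasSpanningTree) (hb : G.IsFrobeniusForm b)
    (hξ : G.IsRootWeight b ξ) (φ α : Fin m → ℝ) (hα : ∀ i, 0 < α i) :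
    ∃ κ, 0 < κ ∧ ∀ S : Run m, IsDecayRun G φ α S →
      S.ApproachesWithRate κ (S.rootAverage ξ) := by
  obtain ⟨δ, hδ, hδα⟩ := exists_pos_forall_le α hα
  obtain ⟨κ, hκ, h⟩ := Run.exists_rate_of_state_bound hG hb hξ (fun _ => 0)
    (fun i => ⟨le_rfl, one_pos⟩) (mul_pos two_pos hδ)
  obtain ⟨Φ, hΦ, hφΦ⟩ := exists_nonneg_forall_le fun i => φ i ^ 2
  refine ⟨κ, hκ, fun S hS => h S Φ hS.motion hΦ fun s i h0 hs => ?_⟩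
  have h1 : decayTest φ α i s (S.x s) (S.xhat s) :=
    hS.motion.test_of_holdsBefore (fun k hk => (hS.rule i k hk).holdsBefore) h0 hs
  have h3 := pow_le_pow_left₀ (abs_nonneg _) h1 2
  rw [sq_abs, mul_pow, ← Real.exp_nat_mul] at h3
  rw [zero_div, zero_mul, zero_add]
  refine h3.trans (mul_le_mul (hφΦ i) (Real.exp_le_exp.2 ?_) (Real.exp_pos _).le hΦ)
  push_cast
  nlinarith [hδα i]

theorem IsDecayRun.T_eq_top {φ α : Fin m → ℝ} {S : Run m} (hS : IsDecayRun G φ α S)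
    (hφ : ∀ i, 0 < φ i) (hα : ∀ i, 0 < α i) {c v : ℝ} (hc : 0 < c)
    (hv : S.ApproachesWithRate c v) : S.T = ⊤ := by
  have hM := hS.motion
  refine hM.T_eq_top fun Tr hTr i hi => ?_
  obtain ⟨C, hC, hv⟩ := hv
  have hx : ∀ j, ∀ s : ℝ, 0 ≤ s → (s : EReal) < S.T → |S.x s j - v| ≤ C := by
    intro j s h0 hs
    refine (hv j s h0 hs).trans (mul_le_of_le_one_right hC (Real.exp_le_one_iff.2 ?_))
    nlinarith
  have hxhat : ∀ j, ∀ s : ℝ, 0 ≤ s → (s : EReal) < S.T → |S.xhat s j - v| ≤ C := by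
    intro j s h0 hs
    obtain ⟨k, h1, h2⟩ := hM.exists_index j h0 hs
    obtain ⟨r, hr, hr0⟩ := hM.exists_coe (h1.trans_lt hs)
    rw [hM.xhat_eq h1 h2, hr, EReal.toReal_coe]
    exact hx j r hr0 (hr ▸ h1.trans_lt hs)
  set M := G.inDegree i * (2 * C) with hMdef
  have hM0 : 0 ≤ M := mul_nonneg (G.inDegree_nonneg i) (by positivity)
  have hrate : ∀ s : ℝ, 0 ≤ s → (s : EReal) < S.T → ‖(G.lap *ᵥ S.xhat s) i‖ ≤ M := by
    intro s h0 hs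
    rw [Real.norm_eq_abs, G.lap_mulVec, hMdef, WeightedDigraph.inDegree, Finset.sum_mul]
    refine (Finset.abs_sum_le_sum_abs _ _).trans (Finset.sum_le_sum fun j _ => ?_)
    rw [abs_mul, abs_of_nonneg (G.nonneg i j)]
    refine mul_le_mul_of_nonneg_left ?_ (G.nonneg i j)
    have h1 := abs_sub_le (S.xhat s j) v (S.xhat s i)
    rw [abs_sub_comm v] at h1
    linarith [hxhat j s h0 hs, hxhat i s h0 hs]
  set g := φ i * Real.exp (-α i * Tr) / (M + 1) with hg
  have hg0 : 0 < g := div_pos (mul_pos (hφ i) (Real.exp_pos _)) (by positivity)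
  have gap : ∀ k, (S.t i k).toReal + g ≤ (S.t i (k + 1)).toReal := by
    intro k
    obtain ⟨r, hr, hr0⟩ := hM.exists_coe (hi k)
    have hold := (hS.rule i k (hi k)).holdsBefore
    rcases hS.rule i k (hi k) with ⟨h1, _⟩ | ⟨s, hs, hsT, hlub⟩
    · exact absurd h1 (not_le.2 (hi (k + 1)))
    rw [hs, min_eq_left hsT.le] at hold
    have hks : S.t i k ≤ (s : EReal) := hs ▸ hM.mono i k.le_succ
    have hrs : r ≤ s := by rw [hr] at hks; exact_mod_cast hks
    have hsTr : s ≤ Tr := by rw [hTr] at hsT; exact_mod_cast hsT.le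
    have hfar : φ i * Real.exp (-α i * s) ≤ |S.x r i - S.x s i| := by
      by_contra! hlt
      set u := (G.lap *ᵥ S.view i k s) i with hu
      have hcont : Continuous fun τ => φ i * Real.exp (-α i * τ) -
          |S.x r i - (S.x s i + (τ - s) * u)| := by fun_prop
      have hev : ∀ᶠ τ in 𝓝 s, 0 < φ i * Real.exp (-α i * τ) -
          |S.x r i - (S.x s i + (τ - s) * u)| :=
        hcont.continuousAt.eventually_const_lt (by simpa using hlt)
      obtain ⟨ρ, hρ, hball⟩ := Metric.eventually_nhds_iff.1 hev
      obtain ⟨q, hq1, hq2, hq⟩ := Run.exists_not_test_of_isLUB hold hks hlub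
        (show s < s + ρ / 2 by linarith)
      refine hq ?_
      have h1 := hball (show dist q s < ρ by
        rw [Real.dist_eq, abs_of_nonneg (by linarith)]; linarith)
      have h2 : S.predState G.lap s (S.view i k s) q i = S.x s i + (q - s) * u := by
        rw [Run.predState]
        split_ifs with h
        · rw [le_antisymm h hq1]; simp
        · rfl
      have h3 : S.view i k s i = S.x r i := by simp [Run.view, hr]
      change |_ - _| ≤ _
      rw [h2, h3]
      linarith
    have hlip : |S.x r i - S.x s i| ≤ M * (s - r) := by
      rw [abs_sub_comm]
      exact norm_image_sub_le_of_norm_deriv_right_le_segment (hM.continuousOn_apply hr0 hsT i)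
        (fun q hq => hM.ode_Ico hr0 hsT i hq)
        (fun q hq => hrate q (hr0.trans hq.1) ((EReal.coe_lt_coe_iff.2 hq.2).trans hsT))
        s ⟨hrs, le_rfl⟩
    have hexp : φ i * Real.exp (-α i * Tr) ≤ φ i * Real.exp (-α i * s) :=
      mul_le_mul_of_nonneg_left (Real.exp_le_exp.2 (by nlinarith [hα i])) (hφ i).le
    rw [hr, hs, EReal.toReal_coe, EReal.toReal_coe]
    have : g ≤ s - r := by
      rw [hg, div_le_iff₀ (by positivity)]
      nlinarith
    linarith
  have hlow : ∀ k : ℕ, k * g ≤ (S.t i k).toReal := by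
    intro k
    induction k with
    | zero => simp [hM.start]
    | succ k ih => push_cast; linarith [gap k]
  obtain ⟨k, hk⟩ := exists_nat_gt (Tr / g)
  rw [div_lt_iff₀ hg0] at hk
  obtain ⟨r, hr, _⟩ := hM.exists_coe (hi k)
  have h1 := hlow k
  have h2 := hi k
  rw [hr, EReal.toReal_coe] at h1
  rw [hr, hTr, EReal.coe_lt_coe_iff] at h2
  linarith

end

noncomputable section

variable {m N : ℕ} {G : WeightedDigraph m} {b : Fin m → Fin (N + 1)}
  {ξ : {p : Fin m // b p = Fin.last N} → ℝ}

/-- A bounded set of reals whose elements are separated by a positive distance is finite. -/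
theorem Set.finite_of_separated {A : Set ℝ} {ε B : ℝ} (hε : 0 < ε) (h0 : ∀ s ∈ A, 0 ≤ s)
    (hB : ∀ s ∈ A, s ≤ B) (hsep : ∀ s ∈ A, ∀ s' ∈ A, s < s' → s + ε ≤ s') : A.Finite := by
  have hlt : ∀ s ∈ A, ∀ s' ∈ A, s < s' → ⌊s / ε⌋₊ < ⌊s' / ε⌋₊ := by
    intro s hs s' hs' h
    rw [Nat.lt_iff_add_one_le, Nat.le_floor_iff (div_nonneg (h0 s' hs') hε.le), le_div_iff₀ hε]
    have h1 := Nat.floor_le (div_nonneg (h0 s hs) hε.le)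
    rw [le_div_iff₀ hε] at h1
    push_cast
    linarith [hsep s hs s' hs' h]
  refine Set.Finite.of_finite_image (f := fun s => ⌊s / ε⌋₊)
    ((Set.finite_Iic ⌊B / ε⌋₊).subset ?_) ?_
  · rintro _ ⟨s, hs, rfl⟩
    exact Nat.floor_le_floor (div_le_div_of_nonneg_right (hB s hs) hε.le)
  · intro s hs s' hs' h
    rcases lt_trichotomy s s' with h1 | h1 | h1
    · exact absurd h (hlt s hs s' hs' h1).ne
    · exact h1
    · exact absurd h (hlt s' hs' s hs h1).ne'

theorem Run.NextByTestOrInfo.holdsBefore {S : Run m} {test : AgentTest m} {ε : Fin m → ℝ}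
    {i : Fin m} {k : ℕ} (h : S.NextByTestOrInfo G test ε i k) :
    S.HoldsBefore test i k (min (S.t i (k + 1)) S.T) := by
  rcases h with ⟨s, hs, hsT, _, _, _, h, _⟩ | ⟨h, _⟩
  · rwa [hs, min_eq_left hsT.le]
  · exact h.holdsBefore

theorem WeightedDigraph.sq_lap_mulVec_le (w : Fin m → ℝ) (i : Fin m) :
    ((G.lap *ᵥ w) i) ^ 2 ≤ G.inDegree i * G.disagreement w i := by
  rw [G.lap_mulVec]
  exact Finset.sum_sq_le_sum_mul_sum_of_sq_le_mul _ (fun j _ => G.nonneg i j)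
    (fun j _ => mul_nonneg (G.nonneg i j) (sq_nonneg _)) (fun j _ => le_of_eq (by ring))

namespace IsBroadcastRun

variable {γ ε : Fin m → ℝ} {S : Run m}

theorem lt_succ (hS : IsBroadcastRun G γ ε S) {i : Fin m} {k : ℕ} (hk : S.t i k < S.T) :
    S.t i k < S.t i (k + 1) := by
  rcases hS.rule i k hk with ⟨s, hs, _, hks, _⟩ | ⟨h, _⟩
  · obtain ⟨r, hr, _⟩ := hS.motion.exists_coe hk
    rw [hr, EReal.toReal_coe] at hks
    rw [hs, hr]
    exact_mod_cast hks
  · exact hS.motion.lt_succ_of_nextByTest (fun n hn => (hS.rule i n hn).holdsBefore) hk h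

/-- A trigger that follows the previous one after less than `ε i` is caused by a trigger of an
in-neighbour at the same instant. -/
theorem long_gap_or_cause (hS : IsBroadcastRun G γ ε S) (hγ : ∀ i, 0 < γ i)
    (hε : ∀ i, 0 < ε i ∧ ε i * (2 * |G.lap i i|) < √(γ i)) {i : Fin m} {k : ℕ} {r₀ s : ℝ}
    (hk : S.t i k = (r₀ : EReal)) (hs : S.t i (k + 1) = (s : EReal)) (hsT : (s : EReal) < S.T) :
    r₀ + ε i ≤ s ∨ ∃ j, S.TriggersAt j s ∧ S.rank s j < S.rank s i := by
  have hM := hS.motion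
  have hkT : S.t i k < S.T := lt_of_le_of_lt (hM.mono i k.le_succ) (hs ▸ hsT)
  have hr0 : 0 ≤ r₀ := by
    have := hM.nonneg i k
    rw [hk] at this
    exact_mod_cast this
  have hrs : r₀ < s := by
    have := hS.lt_succ hkT
    rw [hk, hs] at this
    exact_mod_cast this
  have hold := (hS.rule i k hkT).holdsBefore
  rw [hs, min_eq_left hsT.le] at hold
  rcases hS.rule i k hkT with ⟨s', hs', _, _, _, ⟨j, _, h1, h2⟩, _⟩ | ⟨hnext, hearly⟩
  · rw [hs, EReal.coe_eq_coe_iff] at hs'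
    subst hs'
    exact Or.inr ⟨j, h1, h2⟩
  by_contra! hcon
  obtain ⟨hshort, hcause⟩ := hcon
  rw [hs, min_eq_left hsT.le] at hearly
  rcases hnext with ⟨h, _⟩ | ⟨s', hs', _, hlub⟩
  · exact absurd (hs ▸ h) (not_le.2 hsT)
  rw [hs, EReal.coe_eq_coe_iff] at hs'
  subst hs'
  have hquiet : ∀ j, 0 < G.a i j → ∀ u, r₀ < u → u < s → ¬ S.TriggersAt j u := by
    intro j hj u hu1 hu2 htrig
    refine hearly u (by exact_mod_cast hu2) ⟨?_, ?_, j, hj, htrig⟩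
    · rwa [hk, EReal.toReal_coe]
    · rw [hk, EReal.toReal_coe]; linarith
  set w := S.view i k s with hw
  have hwi : w i = S.x r₀ i := by simp [hw, Run.view, hk]
  have hhat_i : ∀ r ∈ Set.Ico r₀ s, S.xhat r i = w i := by
    intro r hr
    rw [hM.xhat_eq (i := i) (k := k) (hk ▸ by exact_mod_cast hr.1) (hs ▸ by exact_mod_cast hr.2),
      hk, EReal.toReal_coe, hwi]
  have hwj : ∀ j, 0 < G.a i j → w j = S.xhat r₀ j := by
    intro j hj
    have hji : j ≠ i := fun h => by rw [h, G.diag_zero] at hj; exact lt_irrefl _ hj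
    have hks : S.t i k ≠ (s : EReal) := by
      rw [hk]; exact_mod_cast hrs.ne
    by_cases hrank : S.rank s j < S.rank s i
    · have : w j = S.xhat s j := by simp [hw, Run.view, hji, hrank]
      rw [this]
      refine hM.xhat_eq_of_not_triggersAt hr0 hrs.le hsT fun u hu1 hu2 htrig => ?_
      rcases hu2.lt_or_eq with h | h
      · exact hquiet j hj u hu1 h htrig
      · exact absurd (hcause j (h ▸ htrig)) (not_le.2 hrank)
    · have : w j = S.xhatPre s j := by simp [hw, Run.view, hji, hrank, hks]
      rw [this]
      exact hM.xhatPre_eq_of_not_triggersAt hr0 hrs hsT (hquiet j hj)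
  have hhat_j : ∀ r ∈ Set.Ico r₀ s, ∀ j, 0 < G.a i j → S.xhat r j = w j := by
    intro r hr j hj
    rw [hwj j hj]
    exact hM.xhat_eq_of_not_triggersAt hr0 hr.1
      ((EReal.coe_lt_coe_iff.2 hr.2).trans hsT)
      fun u hu1 hu2 => hquiet j hj u hu1 (hu2.trans_lt hr.2)
  set v := (G.lap *ᵥ w) i with hv
  have hrate : ∀ r ∈ Set.Ico r₀ s, (G.lap *ᵥ S.xhat r) i = v := by
    intro r hr
    rw [hv, G.lap_mulVec, G.lap_mulVec]
    refine Finset.sum_congr rfl fun j _ => ?_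
    rcases (G.nonneg i j).eq_or_lt with h | h
    · rw [← h, zero_mul, zero_mul]
    · rw [hhat_j r hr j h, hhat_i r hr]
  have hxs := hM.x_eq_of_rate_const hr0 hsT i hrate ⟨hrs.le, le_rfl⟩
  obtain ⟨q, hq1, hq2, hq⟩ := Run.exists_not_test_of_isLUB hold (hs ▸ hM.mono i k.le_succ) hlub
    hshort
  refine hq ?_
  rw [broadcastTest, G.abs_lap_diag, G.lap_sum_sq, ← hw]
  have hpred : S.predState G.lap s w q i = S.x r₀ i + (q - r₀) * v := by
    rw [Run.predState]
    split_ifs with h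
    · rw [le_antisymm h hq1, hxs]
    · rw [hxs]; ring
  rw [hpred, hwi]
  refine Real.abs_le_sqrt ?_
  have h1 := G.sq_lap_mulVec_le w i
  rw [← hv] at h1
  have hε' := (hε i).2
  rw [G.abs_lap_diag] at hε'
  have hd := G.disagreement_nonneg w i
  have h2 : (S.x r₀ i - (S.x r₀ i + (q - r₀) * v)) ^ 2 = (q - r₀) ^ 2 * v ^ 2 := by ring
  rw [h2]
  rcases (G.inDegree_nonneg i).eq_or_lt with h0 | h0
  · rw [← h0, zero_mul] at h1
    rw [le_antisymm h1 (sq_nonneg v), mul_zero, ← h0, mul_zero, div_zero, zero_mul]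
  · have h3 : (q - r₀) ^ 2 ≤ ε i ^ 2 := pow_le_pow_left₀ (by linarith) (by linarith) 2
    have h4 : (ε i * (2 * G.inDegree i)) ^ 2 ≤ γ i := by
      rw [← Real.sq_sqrt (hγ i).le]
      exact pow_le_pow_left₀ (mul_nonneg (hε i).1.le (by positivity)) hε'.le 2
    calc (q - r₀) ^ 2 * v ^ 2
        ≤ ε i ^ 2 * (G.inDegree i * G.disagreement w i) :=
          mul_le_mul h3 h1 (sq_nonneg v) (sq_nonneg _)
      _ = (ε i * (2 * G.inDegree i)) ^ 2 / (4 * G.inDegree i) * G.disagreement w i := by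
          field_simp; ring
      _ ≤ γ i / (4 * G.inDegree i) * G.disagreement w i :=
          mul_le_mul_of_nonneg_right (div_le_div_of_nonneg_right h4 (by positivity)) hd

theorem T_eq_top (hS : IsBroadcastRun G γ ε S) (hγ : ∀ i, 0 < γ i)
    (hε : ∀ i, 0 < ε i ∧ ε i * (2 * |G.lap i i|) < √(γ i)) : S.T = ⊤ := by
  have hM := hS.motion
  refine hM.T_eq_top fun Tr hTr i hi => ?_
  let A : Fin m → Set ℝ := fun l => {s | (s : EReal) < S.T ∧ ∃ (k : ℕ) (r : ℝ),
    S.t l k = (r : EReal) ∧ S.t l (k + 1) = (s : EReal) ∧ r + ε l ≤ s}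
  have hA : ∀ l, (A l).Finite := by
    intro l
    refine Set.finite_of_separated (hε l).1 (B := Tr) ?_ ?_ ?_
    · rintro s ⟨_, k, r, _, hs, _⟩
      have := hM.nonneg l (k + 1)
      rw [hs] at this
      exact_mod_cast this
    · rintro s ⟨hsT, _⟩
      rw [hTr] at hsT
      exact_mod_cast hsT.le
    · rintro s ⟨_, k, r, _, hs, _⟩ s' ⟨_, k', r', hr', hs', hle⟩ hlt
      have hkk : k < k' := by
        by_contra h
        have := hM.mono l (Nat.succ_le_succ (not_lt.1 h))
        rw [hs, hs'] at this
        exact absurd (EReal.coe_le_coe_iff.1 this) (not_le.2 hlt)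
      have := hM.mono l (Nat.succ_le_of_lt hkk)
      rw [Nat.succ_eq_add_one, hs, hr', EReal.coe_le_coe_iff] at this
      linarith
  have hcover : ∀ s : ℝ, 0 < s → (s : EReal) < S.T → ∀ n l, S.rank s l = n → S.TriggersAt l s →
      s ∈ ⋃ l, A l := by
    intro s h0 hsT n
    induction n using Nat.strong_induction_on with
    | _ n ih =>
      rintro l rfl ⟨k, hk⟩
      cases k with
      | zero =>
        rw [hM.start] at hk
        exact absurd h0 (not_lt.2 (by exact_mod_cast hk.symm.le))
      | succ k =>
        obtain ⟨r, hr, _⟩ := hM.exists_coe (lt_of_le_of_lt (hM.mono l k.le_succ) (hk ▸ hsT))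
        rcases hS.long_gap_or_cause hγ hε hr hk hsT with h | ⟨j, hj, hlt⟩
        · exact Set.mem_iUnion.2 ⟨l, hsT, k, r, hr, hk, h⟩
        · exact ih _ hlt j rfl hj
  have hstrict : StrictMono (S.t i) := strictMono_nat_of_lt_succ fun k => hS.lt_succ (hi k)
  have hinj : Function.Injective fun k => (S.t i (k + 1)).toReal := by
    intro k k' h
    obtain ⟨r, hr, _⟩ := hM.exists_coe (hi (k + 1))
    obtain ⟨r', hr', _⟩ := hM.exists_coe (hi (k' + 1))
    simp only [hr, hr', EReal.toReal_coe] at h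
    exact Nat.succ_injective (hstrict.injective (by rw [Nat.succ_eq_add_one, hr, hr', h]))
  refine Set.infinite_of_injective_forall_mem hinj (fun k => ?_) (Set.finite_iUnion hA)
  obtain ⟨r, hr, _⟩ := hM.exists_coe (hi (k + 1))
  rw [hr, EReal.toReal_coe]
  refine hcover r ?_ (hr ▸ hi (k + 1)) _ i rfl ⟨k + 1, hr⟩
  have := lt_of_le_of_lt (hM.nonneg i 0) (hstrict k.succ_pos)
  rw [Nat.succ_eq_add_one, hr] at this
  exact_mod_cast this

end IsBroadcastRun

theorem exists_rate_broadcastRun (hG : G.HasSpanningTree) (hb : G.IsFrobeniusForm b)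
    (hξ : G.IsRootWeight b ξ) (γ ε : Fin m → ℝ) (hγ : ∀ i, 0 < γ i ∧ γ i < 1) :
    ∃ κ, 0 < κ ∧ ∀ S : Run m, IsBroadcastRun G γ ε S →
      S.ApproachesWithRate κ (S.rootAverage ξ) := by
  obtain ⟨κ, hκ, h⟩ := Run.exists_rate_of_broadcast_bound hG hb hξ γ
    (fun i => ⟨(hγ i).1.le, (hγ i).2⟩)
  refine ⟨κ, hκ, fun S hS => h S hS.motion fun s i h0 hs => ?_⟩
  have h1 : broadcastTest G.lap γ i s (S.x s) (S.xhat s) :=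
    hS.motion.test_of_holdsBefore (fun k hk => (hS.rule i k hk).holdsBefore) h0 hs
  rw [broadcastTest, G.abs_lap_diag, G.lap_sum_sq] at h1
  have h2 : 0 ≤ γ i / (4 * G.inDegree i) * G.disagreement (S.xhat s) i :=
    mul_nonneg (div_nonneg (hγ i).1.le (mul_nonneg (by norm_num) (G.inDegree_nonneg i)))
      (G.disagreement_nonneg _ i)
  have h3 := pow_le_pow_left₀ (abs_nonneg _) h1 2
  rwa [sq_abs, Real.sq_sqrt h2] at h3

theorem Run.IsMotion.T_eq_top_of_tendsto {S : Run m} {L : Matrix (Fin m) (Fin m) ℝ}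
    (hS : S.IsMotion L) (h : ∀ i, Tendsto (S.t i) atTop (𝓝 ⊤)) : S.T = ⊤ := by
  refine hS.T_eq_top fun Tr hTr i hi => ?_
  obtain ⟨k, hk⟩ := ((h i).eventually_const_lt (hTr ▸ EReal.coe_lt_top Tr)).exists
  exact absurd hk (not_lt.2 (hi k).le)

end

theorem mainTheorem1 {m N : ℕ} (G : WeightedDigraph m) (hG : G.HasSpanningTree)
    (b : Fin m → Fin (N + 1)) (hb : G.IsFrobeniusForm b) :
    (∃! ξ : {p : Fin m // b p = Fin.last N} → ℝ, G.IsRootWeight b ξ) ∧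
    ∀ ξ : {p : Fin m // b p = Fin.last N} → ℝ, G.IsRootWeight b ξ →
      (∀ γ : Fin m → ℝ, (∀ i, 0 < γ i ∧ γ i < 1) →
        ∃ c : ℝ, 0 < c ∧ ∀ S : Run m, IsStateRun G γ S →
          (∀ i, Tendsto (S.t i) atTop (𝓝 ⊤)) →
          S.T = ⊤ ∧
          S.ConsensusWithRate c (S.rootAverage ξ) ∧
          (∀ i, Tendsto (fun s => S.x s i) atTop (𝓝 (S.rootAverage ξ))) ∧
          ∀ i k, S.t i k < ⊤ → S.x (S.t i k).toReal i ≠ S.rootAverage ξ →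
            S.t i k < S.t i (k + 1) ∧ S.t i (k + 1) < ⊤) ∧
      (∀ φ α : Fin m → ℝ, (∀ i, 0 < φ i) → (∀ i, 0 < α i) →
        ∃ c : ℝ, 0 < c ∧ ∀ S : Run m, IsDecayRun G φ α S →
          S.T = ⊤ ∧ S.ZenoFree ∧
          S.ConsensusWithRate c (S.rootAverage ξ) ∧
          ∀ i, Tendsto (fun s => S.x s i) atTop (𝓝 (S.rootAverage ξ))) ∧
      (∀ γ ε : Fin m → ℝ, (∀ i, 0 < γ i ∧ γ i < 1) →
        (∀ i, 0 < ε i ∧ ε i * (2 * |G.lap i i|) < √(γ i)) →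
        ∃ c : ℝ, 0 < c ∧ ∀ S : Run m, IsBroadcastRun G γ ε S →
          S.T = ⊤ ∧ S.ZenoFree ∧
          S.ConsensusWithRate c (S.rootAverage ξ) ∧
          ∀ i, Tendsto (fun s => S.x s i) atTop (𝓝 (S.rootAverage ξ))) := by
  refine ⟨hb.existsUnique_rootWeight, fun ξ hξ => ⟨fun γ hγ => ?_, fun φ α hφ hα => ?_,
    fun γ ε hγ hε => ?_⟩⟩
  · obtain ⟨c, hc, h⟩ := exists_rate_stateRun hG hb hξ γ hγ
    refine ⟨c, hc, fun S hS hlim => ?_⟩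
    have hT := hS.motion.T_eq_top_of_tendsto hlim
    have hcons := (h S hS).consensusWithRate hT
    exact ⟨hT, hcons, hcons.tendsto hc,
      fun i k hk hne => hS.lt_succ_lt_top hT (hcons.tendsto hc) hk hne⟩
  · obtain ⟨c, hc, h⟩ := exists_rate_decayRun hG hb hξ φ α hα
    refine ⟨c, hc, fun S hS => ?_⟩
    have hT := hS.T_eq_top hφ hα hc (h S hS)
    have hcons := (h S hS).consensusWithRate hT
    exact ⟨hT, hS.motion.zenoFree hT, hcons, hcons.tendsto hc⟩
  · obtain ⟨c, hc, h⟩ := exists_rate_broadcastRun hG hb hξ γ ε hγ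
    refine ⟨c, hc, fun S hS => ?_⟩
    have hT := hS.T_eq_top (fun i => (hγ i).1) hε
    have hcons := (h S hS).consensusWithRate hT
    exact ⟨hT, hS.motion.zenoFree hT, hcons, hcons.tendsto hc⟩
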